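/- All graphs are finite, simple and undirected. Let $G$ be a planar graph in which no $4$-cycle is adjacent to a $3$-cycle, i.e. no $4$-cycle has an edge in common with a $3$-cycle. Then $G$ is DP-vertex-$2$-arborable. Explicitly, this means the following. Let $L$ assign to every vertex $v$ of $G$ a set $L(v)$ of exactly two colors, and let $H$ be any cover of $G$, that is, a graph with vertex set $\bigcup_{u\in V(G)}\{u\}\times L(u)$ such that (i) for every $u\in V(G)$ the set $\{u\}\times L(u)$ induces a complete graph in $H$; (ii) for every edge $uv$ of $G$ the edges of $H$ between $\{u\}\times L(u)$ and $\{v\}\times L(v)$ form a (possibly empty) matching; (iii) for distinct non-adjacent vertices $u,v$ of $G$ there is no edge of $H$ between $\{u\}\times L(u)$ and $\{v\}\times L(v)$. Then there is a representative set $S$, that is, a set $S\subseteq V(H)$ with $|S|=|V(G)|$ any two different members of which have different first coordinates, such that the representative graph $G_S$ is a forest, where $G_S$ is the graph with vertex set $V(G)$ in which $u$ and $v$ are adjacent if and only if there are $(u,c),(v,c')\in S$ that are adjacent in $H$. -/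

import Mathlib

universe u w

namespace DPArboricity

/-- A rotation system of a graph: a permutation of the darts (oriented edges) which, at every
vertex, permutes the darts leaving that vertex in one single cycle. It records the cyclic order
of the edges around each vertex in an embedding in an oriented closed surface. -/
structure RotationSystem {V : Type*} (G : SimpleGraph V) where
  rot : Equiv.Perm G.Dart
  fst_rot : ∀ d : G.Dart, (rot d).fst = d.fst
  sameCycle : ∀ d d' : G.Dart, d.fst = d'.fst → rot.SameCycle d d'

/-- Face tracing: after walking along `d`, continue with the dart that follows the reversal
of `d` in the rotation at the head of `d`. -/
def RotationSystem.facePerm {V : Type*} {G : SimpleGraph V} (R : RotationSystem G) :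
    Equiv.Perm G.Dart :=
  (Function.Involutive.toPerm SimpleGraph.Dart.symm SimpleGraph.Dart.symm_involutive).trans R.rot

/-- The number of faces of an embedding, every connected component being embedded in a closed
surface of its own. The faces of a component that has an edge are the orbits of face tracing;
a component that consists of an isolated vertex has exactly one face. -/
noncomputable def RotationSystem.numFaces {V : Type*} {G : SimpleGraph V}
    (R : RotationSystem G) : ℕ :=
  Nat.card (Quotient (Equiv.Perm.SameCycle.setoid R.facePerm)) +
    Nat.card {v : V // ∀ w, ¬ G.Adj v w}

/-- A finite graph is planar if it has a combinatorial embedding in which every connected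
component lies on a sphere. A connected component has Euler characteristic at most two, with
equality exactly for the sphere, so this says that the Euler characteristic
`#vertices - #edges + #faces` is twice the number of connected components. -/
def IsPlanar {V : Type*} (G : SimpleGraph V) : Prop :=
  ∃ R : RotationSystem G,
    Nat.card V + R.numFaces = Nat.card G.edgeSet + 2 * Nat.card G.ConnectedComponent

/-- Some 4-cycle is adjacent to some 3-cycle, that is, they have a common edge. -/
def HasFourCycleAdjThreeCycle {V : Type*} (G : SimpleGraph V) : Prop :=
  ∃ (u v : V) (p : G.Walk u u) (q : G.Walk v v),
    p.IsCycle ∧ p.length = 4 ∧ q.IsCycle ∧ q.length = 3 ∧ ∃ e, e ∈ p.edges ∧ e ∈ q.edges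

/-- The vertex set `⋃ u, {u} × L u` of a cover. -/
abbrev CoverVertex {V C : Type*} (L : V → Finset C) : Type _ := Σ u : V, {c : C // c ∈ L u}

/-- `H` is a cover of `G` with respect to the list assignment `L`. -/
structure IsCover {V C : Type*} (G : SimpleGraph V) (L : V → Finset C)
    (H : SimpleGraph (CoverVertex L)) : Prop where
  /-- Over each vertex of `G` there is a complete graph. -/
  complete : ∀ (u : V) (c c' : {c : C // c ∈ L u}), c ≠ c' → H.Adj ⟨u, c⟩ ⟨u, c'⟩
  /-- Over each edge of `G` there is a matching: no element of either side has two neighbours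
  on the other side (the other side is covered by exchanging `u` and `v`). -/
  matching : ∀ u v : V, G.Adj u v → ∀ (c : {c : C // c ∈ L u}) (d d' : {c : C // c ∈ L v}),
    H.Adj ⟨u, c⟩ ⟨v, d⟩ → H.Adj ⟨u, c⟩ ⟨v, d'⟩ → d = d'
  /-- There are no edges over a pair of distinct non-adjacent vertices of `G`. -/
  not_adj : ∀ u v : V, u ≠ v → ¬ G.Adj u v →
    ∀ (c : {c : C // c ∈ L u}) (d : {c : C // c ∈ L v}), ¬ H.Adj ⟨u, c⟩ ⟨v, d⟩

/-- A representative set: as many elements as `G` has vertices, and different elements lie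
over different vertices of `G`. -/
def IsRepresentativeSet {V C : Type*} (L : V → Finset C) (S : Finset (CoverVertex L)) : Prop :=
  S.card = Nat.card V ∧ ∀ x ∈ S, ∀ y ∈ S, x ≠ y → x.1 ≠ y.1

/-- The representative graph of `S`, a graph on the vertices of `G`. (The clause `u ≠ v`
holds automatically when `S` is a representative set.) -/
def representativeGraph {V C : Type*} {L : V → Finset C} (H : SimpleGraph (CoverVertex L))
    (S : Finset (CoverVertex L)) : SimpleGraph V where
  Adj u v := u ≠ v ∧ ∃ (c : {c : C // c ∈ L u}) (d : {c : C // c ∈ L v}),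
    (⟨u, c⟩ : CoverVertex L) ∈ S ∧ (⟨v, d⟩ : CoverVertex L) ∈ S ∧ H.Adj ⟨u, c⟩ ⟨v, d⟩
  symm := ⟨fun _ _ ⟨h, c, d, hc, hd, hcd⟩ => ⟨h.symm, d, c, hd, hc, hcd.symm⟩⟩
  loopless := ⟨fun _ h => h.1 rfl⟩

/-- A DP-forested-coloring: a representative set whose representative graph is a forest. -/
def IsDPForestedColoring {V C : Type*} {L : V → Finset C} (H : SimpleGraph (CoverVertex L))
    (S : Finset (CoverVertex L)) : Prop :=
  IsRepresentativeSet L S ∧ (representativeGraph H S).IsAcyclic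

/-- `G` is DP-vertex-`k`-arborable: for every `k`-assignment and every cover there is a
DP-forested-coloring. -/
def IsDPVertexArborable {V : Type u} (G : SimpleGraph V) (k : ℕ) : Prop :=
  ∀ (C : Type w) (L : V → Finset C), (∀ v, (L v).card = k) →
    ∀ H : SimpleGraph (CoverVertex L), IsCover G L H →
      ∃ S : Finset (CoverVertex L), IsDPForestedColoring H S

end DPArboricity

/-! Colour the vertices one at a time so that each new colour is matched with the colour of at most
one earlier vertex; the representative graph is then a forest (`Buildable.isAcyclic`). The colour of
a neighbour is matched with at most one of the two colours of a vertex, so a vertex with at most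
three coloured neighbours always has an admissible colour. By induction on vertex sets `S`, it
remains to treat `S` inducing a subgraph of minimum degree at least four. There a five-cycle and a
triangle with a common edge exist, all six vertices having degree four in `S`
(`exists_theta_of_planar`). They have no further adjacencies, and a finite check shows that any
colouring of the rest extends to them (`greedySearch_theta`, `extend_theta`).

The configuration is found by discharging. Vertices carry degree minus four and faces length minus
four, scaled by 30; Euler's formula makes the total negative. A triangular face lacks 30 and takes
10 across each edge from a face of length at least five. Faces of length at least six can afford
this, a pentagon has only 30. Vertices of degree at least five help through `cornerGift`. A pentagon
without such vertices gets 4 at each corner between two triangular edges from the opposite face at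
that corner: if the configuration is absent, the apexes of both triangles have degree at least five,
and this enables the opposite face to pay. Both totals, over vertices and over faces, end up
nonnegative (`SparseMap.sum_nonpos`), a contradiction.

Planarity is used only as the inequality `Spherical` between numbers of cycles. It survives the
deletion of edges, so the map of the subgraph induced by `S` lives on the darts of the whole graph,
deleted darts being fixed points. -/

open Equiv Equiv.Perm Function

namespace DPArboricity

/-! ### Counting classes and cycles under a transposition -/

section Setoids

variable {D : Type*} [Finite D]

theorem card_quotient_antitone {s t : Setoid D} (h : s ≤ t) :
    Nat.card (Quotient t) ≤ Nat.card (Quotient s) :=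
  Nat.card_le_card_of_surjective (Quotient.map' id fun _ _ hab => h hab)
    (fun q => Quotient.inductionOn' q fun a => ⟨Quotient.mk'' a, rfl⟩)

theorem card_quotient_lt {s t : Setoid D} (h : s ≤ t) {x y : D} (ht : t x y) (hs : ¬ s x y) :
    Nat.card (Quotient t) < Nat.card (Quotient s) := by
  classical
  cases nonempty_fintype D
  have := Fintype.ofFinite (Quotient s)
  have := Fintype.ofFinite (Quotient t)
  rw [Nat.card_eq_fintype_card, Nat.card_eq_fintype_card]
  refine Fintype.card_lt_of_surjective_not_injective
    (Quotient.map' (s₁ := s) (s₂ := t) id fun _ _ hab => h hab)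
    (fun q => Quotient.inductionOn' q fun a => ⟨Quotient.mk'' a, rfl⟩) fun hinj => hs ?_
  have : (Quotient.mk'' x : Quotient s) = Quotient.mk'' y := hinj (Quotient.sound' ht)
  exact Quotient.exact' this

/-- Identifying two classes lowers the number of classes by at most one. -/
theorem card_quotient_le_succ {s t : Setoid D} {x y : D}
    (h : ∀ r : Setoid D, s ≤ r → r x y → t ≤ r) :
    Nat.card (Quotient s) ≤ Nat.card (Quotient t) + 1 := by
  classical
  -- `m` redirects the class of `x` to that of `y`, hence factors through `Quotient t`. It misses at
  -- most the class of `x`, which `none` supplies in `g`.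
  let m : D → Quotient s := fun a => if s a x then Quotient.mk'' y else Quotient.mk'' a
  have hm : t ≤ Setoid.ker m := by
    refine h _ (fun a b hab => ?_) ?_
    · have hiff : s a x ↔ s b x := ⟨fun q => s.trans (s.symm hab) q, fun q => s.trans hab q⟩
      simp only [Setoid.ker_def, m, hiff]
      split_ifs
      · rfl
      · exact Quotient.sound' hab
    · simp only [Setoid.ker_def, m, s.refl, if_true]
      split_ifs <;> rfl
  let g : Option (Quotient t) → Quotient s := fun o =>
    o.elim (Quotient.mk'' x) (Quotient.lift m fun a b hab => hm hab)
  have hg : Surjective g := by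
    intro q
    refine Quotient.inductionOn' q fun a => ?_
    by_cases ha : s a x
    · exact ⟨none, Quotient.sound' (s.symm ha)⟩
    · exact ⟨some (Quotient.mk'' a), by simp [g, m, Quotient.mk'', ha]⟩
  have := Nat.card_le_card_of_surjective g hg
  rwa [Finite.card_option] at this

end Setoids

section PermRelations

variable {D : Type*}

theorem sameCycle_inv_apply_self (π : Perm D) (a : D) : π.SameCycle a (π⁻¹ a) :=
  ⟨-1, by simp⟩

theorem apply_rel (π : Perm D) (a : D) : SameCycle.setoid π a (π a) :=
  sameCycle_apply_right.2 (SameCycle.refl π a)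

variable [DecidableEq D]

theorem rel_mul_swap_apply {π : Perm D} {r : Setoid D} (h : ∀ a, r a (π a)) {x y : D}
    (hxy : r x y) (a : D) : r a ((π * swap x y) a) := by
  rw [Perm.mul_apply]
  refine r.trans ?_ (h _)
  by_cases hax : a = x
  · subst hax; simpa using hxy
  by_cases hay : a = y
  · subst hay; simpa using r.symm hxy
  rw [swap_apply_of_ne_of_ne hax hay]

theorem mul_swap_cancel (π : Perm D) (x y : D) : π * swap x y * swap x y = π := by
  rw [mul_assoc, swap_mul_self, mul_one]

end PermRelations

section Cycles

variable {D : Type*} [Finite D]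

/-- The number of cycles of a permutation, fixed points included. -/
noncomputable def numCycles (π : Perm D) : ℕ := Nat.card (Quotient (SameCycle.setoid π))

theorem setoid_le_of_apply {π : Perm D} {r : Setoid D} (h : ∀ a, r a (π a)) :
    SameCycle.setoid π ≤ r := by
  intro a b hab
  obtain ⟨n, rfl⟩ := SameCycle.exists_nat_pow_eq hab
  clear hab
  induction n with
  | zero => exact r.refl _
  | succ n ih =>
    rw [pow_succ', Perm.mul_apply]
    exact r.trans ih (h _)

variable [DecidableEq D]

theorem numCycles_le_succ (π : Perm D) (x y : D) :
    numCycles π ≤ numCycles (π * swap x y) + 1 :=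
  card_quotient_le_succ fun _ hr hxy =>
    setoid_le_of_apply (rel_mul_swap_apply (fun a => hr (apply_rel π a)) hxy)

/-- From `x` the new permutation runs through `π y, π² y, …` up to `π ^ m y = x` and closes up
there; minimality of `m` keeps `y` off this stretch. -/
theorem not_sameCycle_mul_swap {π : Perm D} {x y : D} (hne : x ≠ y) (h : π.SameCycle x y) :
    ¬ (π * swap x y).SameCycle x y := by
  obtain ⟨m, hm, hmin⟩ : ∃ m : ℕ, (π ^ m) y = x ∧ ∀ i < m, (π ^ i) y ≠ x := by
    have hex : ∃ m : ℕ, (π ^ m) y = x := SameCycle.exists_nat_pow_eq h.symm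
    exact ⟨Nat.find hex, Nat.find_spec hex, fun i hi => Nat.find_min hex hi⟩
  have hy : ∀ i, 1 ≤ i → i ≤ m → (π ^ i) y ≠ y := by
    intro i h1 h2 hi
    refine hmin (m - i) (by omega) ?_
    have : (π ^ m) y = (π ^ (m - i)) ((π ^ i) y) := by
      rw [← Perm.mul_apply, ← pow_add]; congr 2; omega
    rw [hi] at this
    rw [← this, hm]
  have hm1 : 1 ≤ m := by
    rcases Nat.eq_zero_or_pos m with rfl | h0
    · exact absurd hm.symm (by simpa using hne)
    · exact h0
  have key : ∀ n : ℕ, ∃ i, 1 ≤ i ∧ i ≤ m ∧ ((π * swap x y) ^ n) x = (π ^ i) y := by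
    intro n
    induction n with
    | zero => exact ⟨m, hm1, le_rfl, by simp [hm]⟩
    | succ n ih =>
      obtain ⟨i, h1, h2, h3⟩ := ih
      rw [pow_succ', Perm.mul_apply, h3, Perm.mul_apply]
      rcases eq_or_lt_of_le h2 with rfl | hlt
      · exact ⟨1, le_rfl, hm1, by rw [hm, swap_apply_left, pow_one]⟩
      · refine ⟨i + 1, by omega, hlt, ?_⟩
        rw [swap_apply_of_ne_of_ne (hmin i hlt) (hy i h1 h2), pow_succ', Perm.mul_apply]
  intro hc
  obtain ⟨n, hn⟩ := SameCycle.exists_nat_pow_eq hc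
  obtain ⟨i, h1, h2, h3⟩ := key n
  exact hy i h1 h2 (h3.symm.trans hn)

/-- From `x` the new permutation first traverses the `π`-cycle of `y`, which does not contain `x`,
and so reaches `y` after `m` steps. -/
theorem sameCycle_mul_swap {π : Perm D} {x y : D} (h : ¬ π.SameCycle x y) :
    (π * swap x y).SameCycle x y := by
  obtain ⟨m, hm0, hm, hmin⟩ : ∃ m : ℕ, 0 < m ∧ (π ^ m) y = y ∧
      ∀ i, 0 < i → i < m → (π ^ i) y ≠ y := by
    have hex : ∃ m : ℕ, 0 < m ∧ (π ^ m) y = y :=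
      ⟨orderOf π, orderOf_pos π, by rw [pow_orderOf_eq_one, Perm.one_apply]⟩
    exact ⟨Nat.find hex, (Nat.find_spec hex).1, (Nat.find_spec hex).2,
      fun i h0 hi hc => Nat.find_min hex hi ⟨h0, hc⟩⟩
  have hx : ∀ i : ℕ, (π ^ i) y ≠ x := fun i hi =>
    h (SameCycle.symm ⟨i, by simpa using hi⟩)
  have key : ∀ i, i < m → ((π * swap x y) ^ (i + 1)) x = (π ^ (i + 1)) y := by
    intro i
    induction i with
    | zero => intro _; simp
    | succ i ih =>
      intro hi
      rw [pow_succ', Perm.mul_apply, ih (by omega), Perm.mul_apply,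
        swap_apply_of_ne_of_ne (hx _) (hmin _ (by omega) hi), pow_succ' π (i + 1), Perm.mul_apply]
  refine ⟨m, ?_⟩
  have := key (m - 1) (by omega)
  rw [Nat.sub_add_cancel hm0, hm] at this
  simpa using this

theorem numCycles_succ_le {π : Perm D} {x y : D} (hne : x ≠ y) (h : π.SameCycle x y) :
    numCycles π + 1 ≤ numCycles (π * swap x y) :=
  card_quotient_lt
    (setoid_le_of_apply (r := SameCycle.setoid π) (rel_mul_swap_apply (apply_rel π) h))
    (x := x) (y := y) h (not_sameCycle_mul_swap hne h)

end Cycles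

/-! ### Deleting edges from a spherical map -/

section Skip

variable {D : Type*} [DecidableEq D]

/-- Remove the point `d` from its cycle, so that it becomes a fixed point. -/
def skip (σ : Perm D) (d : D) : Perm D := σ * swap d (σ⁻¹ d)

theorem skip_apply_self (σ : Perm D) (d : D) : skip σ d d = d := by simp [skip]

theorem skip_apply_of_ne {σ : Perm D} {d a : D} (h1 : a ≠ d) (h2 : σ a ≠ d) :
    skip σ d a = σ a := by
  rw [skip, Perm.mul_apply, swap_apply_of_ne_of_ne h1]
  rintro rfl
  simp at h2

theorem skip_apply_of_eq {σ : Perm D} {d a : D} (h2 : σ a = d) : skip σ d a = σ d := by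
  have : a = σ⁻¹ d := by rw [← h2]; simp
  rw [skip, Perm.mul_apply, this, swap_apply_right]

end Skip

section Spherical

variable {D : Type*}

/-- Two elements are connected when some product of the two permutations and their inverses
takes one to the other. -/
def connSetoid (σ α : Perm D) : Setoid D := SameCycle.setoid σ ⊔ SameCycle.setoid α

theorem connSetoid_left (σ α : Perm D) (a : D) : connSetoid σ α a (σ a) :=
  (le_sup_left : SameCycle.setoid σ ≤ connSetoid σ α) (apply_rel σ a)

theorem connSetoid_right (σ α : Perm D) (a : D) : connSetoid σ α a (α a) :=
  (le_sup_right : SameCycle.setoid α ≤ connSetoid σ α) (apply_rel α a)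

variable [Finite D]

theorem connSetoid_le {σ α : Perm D} {r : Setoid D} (hσ : ∀ a, r a (σ a)) (hα : ∀ a, r a (α a)) :
    connSetoid σ α ≤ r :=
  sup_le (setoid_le_of_apply hσ) (setoid_le_of_apply hα)

theorem sameCycle_mul_le_connSetoid (σ α : Perm D) :
    SameCycle.setoid (σ * α) ≤ connSetoid σ α :=
  setoid_le_of_apply fun a =>
    (connSetoid σ α).trans (connSetoid_right σ α a) (connSetoid_left σ α (α a))

/-- The hypermap of two permutations has Euler characteristic at least twice its number of
connected components. -/
def Spherical (σ α : Perm D) : Prop :=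
  Nat.card D + 2 * Nat.card (Quotient (connSetoid σ α)) ≤
    numCycles σ + numCycles α + numCycles (σ * α)

variable [DecidableEq D]

/-- Splitting a cycle of `α` gains one cycle. If `x` and `y` stay connected, the number of
components does not grow and `σ * α` loses at most one cycle. Otherwise at most one component is
gained, but then `x` and `y` shared a cycle of `σ * α`, which splits as well. -/
theorem Spherical.cut {σ α : Perm D} (h : Spherical σ α) {x y : D} (hne : x ≠ y)
    (hxy : α.SameCycle x y) : Spherical σ (α * swap x y) := by
  have h1 := numCycles_succ_le hne hxy
  have hback : ∀ r : Setoid D, connSetoid σ (α * swap x y) ≤ r → r x y → connSetoid σ α ≤ r := by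
    intro r hr hrxy
    refine connSetoid_le (fun a => hr (connSetoid_left _ _ a)) fun a => ?_
    have := rel_mul_swap_apply (fun a => hr (connSetoid_right σ (α * swap x y) a)) hrxy a
    rwa [mul_swap_cancel] at this
  unfold Spherical at *
  by_cases hc : connSetoid σ (α * swap x y) x y
  · have h2 := card_quotient_antitone (hback _ le_rfl hc)
    have h3 := numCycles_le_succ (σ * α) x y
    rw [mul_assoc] at h3
    omega
  · have h2 := card_quotient_le_succ hback
    have h3 : (σ * α).SameCycle x y := by
      have h4 : ¬ (σ * (α * swap x y)).SameCycle x y := fun h4 =>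
        hc (sameCycle_mul_le_connSetoid _ _ h4)
      have := sameCycle_mul_swap h4
      rwa [← mul_assoc, mul_swap_cancel] at this
    have h4 := numCycles_succ_le hne h3
    rw [mul_assoc] at h4
    omega

/-- Unless `σ` already fixes `d`, both `σ` and `σ * α` gain a cycle, which pays for the at most one
new component. -/
theorem Spherical.skip {σ α : Perm D} (h : Spherical σ α) {d : D} (hd : α d = d) :
    Spherical (skip σ d) α := by
  by_cases hσ : σ⁻¹ d = d
  · have : DPArboricity.skip σ d = σ := by
      rw [DPArboricity.skip, hσ, swap_self]; rfl
    rwa [this]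
  have hs : σ.SameCycle d (σ⁻¹ d) := sameCycle_inv_apply_self _ _
  have h1 := numCycles_succ_le (Ne.symm hσ) hs
  have hd' : α⁻¹ d = d := by rw [Perm.inv_eq_iff_eq, hd]
  -- As `α` fixes `d`, conjugating the transposition by `α` turns skipping `d` in `σ` into skipping
  -- `d` in `σ * α`.
  have hφ : DPArboricity.skip σ d * α = (σ * α) * swap d ((σ * α)⁻¹ d) := by
    have : (σ * α)⁻¹ d = α⁻¹ (σ⁻¹ d) := by simp
    rw [this]
    have h2 : swap d (α⁻¹ (σ⁻¹ d)) = α⁻¹ * swap d (σ⁻¹ d) * α := by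
      have := (swap_apply_apply α⁻¹ d (σ⁻¹ d))
      rw [hd'] at this
      simpa using this
    rw [h2, DPArboricity.skip]
    group
  have h2 : numCycles (σ * α) + 1 ≤ numCycles (DPArboricity.skip σ d * α) := by
    rw [hφ]
    refine numCycles_succ_le (fun he => hσ ?_) (sameCycle_inv_apply_self _ _)
    have h3 : (σ * α) d = d := by rw [← Perm.inv_eq_iff_eq.1 he.symm]
    rw [Perm.inv_eq_iff_eq]
    simpa [hd] using h3.symm
  have h3 : Nat.card (Quotient (connSetoid (DPArboricity.skip σ d) α)) ≤
      Nat.card (Quotient (connSetoid σ α)) + 1 := by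
    refine card_quotient_le_succ (x := d) (y := σ⁻¹ d) fun r hr hxy => connSetoid_le ?_ ?_
    · intro a
      have := rel_mul_swap_apply
        (fun a => hr (connSetoid_left (DPArboricity.skip σ d) α a)) hxy a
      rwa [DPArboricity.skip, mul_swap_cancel] at this
    · exact fun a => hr (connSetoid_right _ _ a)
  unfold Spherical at *
  have h4 : numCycles (DPArboricity.skip σ d) = numCycles (σ * swap d (σ⁻¹ d)) := rfl
  omega

theorem sameCycle_skip {σ : Perm D} {d a b : D} (ha : a ≠ d) (hb : b ≠ d)
    (h : σ.SameCycle a b) : (skip σ d).SameCycle a b := by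
  -- When the `σ`-orbit stands at `d`, the skipping permutation has already jumped to `σ d`.
  have key : ∀ n : ℕ, ((σ ^ n) a ≠ d → (skip σ d).SameCycle a ((σ ^ n) a)) ∧
      ((σ ^ n) a = d → (skip σ d).SameCycle a (σ d)) := by
    intro n
    induction n with
    | zero => exact ⟨fun _ => SameCycle.refl _ _, fun h => absurd h ha⟩
    | succ n ih =>
      rw [pow_succ', Perm.mul_apply]
      by_cases hn : (σ ^ n) a = d
      · rw [hn]
        exact ⟨fun _ => ih.2 hn, fun h => by rw [h]; have := ih.2 hn; rwa [h] at this⟩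
      · have h1 := sameCycle_apply_right.2 (ih.1 hn)
        refine ⟨fun h => by rwa [skip_apply_of_ne hn h] at h1,
          fun h => by rwa [skip_apply_of_eq h] at h1⟩
  obtain ⟨n, rfl⟩ := SameCycle.exists_nat_pow_eq h
  exact (key n).1 hb

end Spherical

/-! ### Sums over darts in place of sums over vertices and faces -/

section CycleSums

variable {D : Type*}

theorem minimalPeriod_eq_card_sameCycle [Finite D] (π : Perm D) (d : D) :
    minimalPeriod π d = Nat.card {y // π.SameCycle d y} := by
  classical
  cases nonempty_fintype D
  have h := MulAction.minimalPeriod_eq_card (a := π) (b := d)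
  have h2 : (fun x : D => π • x) = π := rfl
  rw [h2] at h
  rw [h, ← Nat.card_eq_fintype_card]
  refine Nat.card_congr (Equiv.subtypeEquivRight fun y => ?_)
  simp only [MulAction.mem_orbit_iff, SameCycle, Subgroup.exists_zpowers, Subgroup.smul_def]
  rfl

theorem minimalPeriod_pos [Finite D] (π : Perm D) (d : D) : 0 < minimalPeriod π d := by
  rw [minimalPeriod_eq_card_sameCycle]
  have : Nonempty {y // π.SameCycle d y} := ⟨⟨d, SameCycle.refl _ _⟩⟩
  exact Nat.card_pos

theorem minimalPeriod_congr [Finite D] {π : Perm D} {d e : D} (h : π.SameCycle d e) :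
    minimalPeriod π d = minimalPeriod π e := by
  rw [minimalPeriod_eq_card_sameCycle, minimalPeriod_eq_card_sameCycle]
  exact Nat.card_congr (Equiv.subtypeEquivRight fun y =>
    ⟨fun q => h.symm.trans q, fun q => h.trans q⟩)

/-- A cycle of length `n` contributes `n` terms `1 / n`. This lets the discharging be done dart by
dart. -/
theorem sum_inv_minimalPeriod [Fintype D] (π : Perm D) :
    ∑ d, (1 / (minimalPeriod π d : ℚ)) = numCycles π := by
  classical
  have := Fintype.ofFinite (Quotient (SameCycle.setoid π))
  rw [← Finset.sum_fiberwise (g := fun d => (Quotient.mk'' d : Quotient (SameCycle.setoid π)))]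
  have key : ∀ q : Quotient (SameCycle.setoid π),
      ∑ d with (Quotient.mk'' d : Quotient (SameCycle.setoid π)) = q,
        (1 / (minimalPeriod π d : ℚ)) = 1 := by
    intro q
    refine Quotient.inductionOn' q fun a => ?_
    have h1 : ∀ d ∈ Finset.univ.filter fun d =>
        (Quotient.mk'' d : Quotient (SameCycle.setoid π)) = Quotient.mk'' a,
        (1 / (minimalPeriod π d : ℚ)) = 1 / (minimalPeriod π a : ℚ) := by
      intro d hd
      have : π.SameCycle d a := Quotient.exact' (Finset.mem_filter.1 hd).2
      rw [minimalPeriod_congr this]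
    rw [Finset.sum_congr rfl h1, Finset.sum_const, nsmul_eq_mul]
    have h2 : (Finset.univ.filter fun d =>
        (Quotient.mk'' d : Quotient (SameCycle.setoid π)) = Quotient.mk'' a).card =
        minimalPeriod π a := by
      rw [minimalPeriod_eq_card_sameCycle, Nat.card_eq_fintype_card, Fintype.card_subtype]
      congr 1
      ext d
      simp only [Finset.mem_filter, Finset.mem_univ, true_and]
      exact ⟨fun q => (Quotient.exact' q : π.SameCycle d a).symm,
        fun q => Quotient.sound' (q.symm : π.SameCycle d a)⟩
    rw [h2]
    have := minimalPeriod_pos π a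
    field_simp
  rw [Finset.sum_congr rfl fun q _ => key q]
  simp [numCycles, Nat.card_eq_fintype_card]

theorem sum_filter_comp [Fintype D] {π : Perm D} {P : D → Prop} [DecidablePred P]
    (hP : ∀ d, P (π d) ↔ P d) (f : D → ℚ) :
    ∑ d with P d, f (π d) = ∑ d with P d, f d := by
  rw [Finset.sum_filter, Finset.sum_filter, ← Equiv.sum_comp π fun d => if P d then f d else 0]
  simp only [hP]

/-- The potential `h` cancels because `P` is invariant; it describes charge moved between successive
corners of a cycle. -/
theorem sum_filter_nonneg_of_telescope [Fintype D] {π : Perm D} {P : D → Prop} [DecidablePred P]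
    (hP : ∀ d, P (π d) ↔ P d) (f h : D → ℚ) (hf : ∀ d, P d → 0 ≤ f d + h (π d) - h d) :
    0 ≤ ∑ d with P d, f d := by
  have h1 : ∑ d with P d, f d = ∑ d with P d, (f d + h (π d) - h d) := by
    rw [Finset.sum_sub_distrib, Finset.sum_add_distrib, sum_filter_comp hP h]
    ring
  rw [h1]
  exact Finset.sum_nonneg fun d hd => hf d (Finset.mem_filter.1 hd).2

/-- Every term occurs in five windows. For cycles of length five a window is the whole cycle, so an
inequality per cycle suffices. -/
theorem sum_filter_nonneg_of_window [Fintype D] {π : Perm D} {P : D → Prop} [DecidablePred P]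
    (hP : ∀ d, P (π d) ↔ P d) (f : D → ℚ) (hf : ∀ d, P d →
      0 ≤ f d + f (π d) + f (π (π d)) + f (π (π (π d))) + f (π (π (π (π d))))) :
    0 ≤ ∑ d with P d, f d := by
  have h1 : ∑ d with P d, (f d + f (π d) + f (π (π d)) + f (π (π (π d))) +
      f (π (π (π (π d))))) = 5 * ∑ d with P d, f d := by
    simp only [Finset.sum_add_distrib]
    have e1 := sum_filter_comp hP f
    have e2 := sum_filter_comp hP fun d => f (π d)
    have e3 := sum_filter_comp hP fun d => f (π (π d))
    have e4 := sum_filter_comp hP fun d => f (π (π (π d)))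
    rw [e4, e3, e2, e1]
    ring
  suffices h : 0 ≤ 5 * ∑ d with P d, f d by linarith
  rw [← h1]
  exact Finset.sum_nonneg fun d hd => hf d (Finset.mem_filter.1 hd).2

end CycleSums

/-! ### Discharging rules and their finite checks -/

/-- The numerical value of a truth value. -/
def ind (b : Bool) : ℤ := if b then 1 else 0

/-- What a vertex gives to a face at one of its corners. Here `b` says that the vertex has degree
at least five, `s` and `t` say that the two edges of the face at the corner lie on a triangle on
the other side. At the far end of the first edge, `p` says that the vertex has degree at least
five and `s'` that the preceding edge of the face lies on a triangle; `q` and `t'` say the same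
about the far end of the second edge. -/
def cornerGift (b s t p s' q t' : Bool) : ℤ :=
  if b then
    if s then (if t then 20 else if q then 5 else if t' then 10 else 0)
    else if t then (if p then 5 else if s' then 10 else 0)
    else 0
  else 0

/-- The corner of a face at a vertex of degree four between two vertices of larger degree, both
its edges lying on triangles on the other side. -/
def alternating (s t p b q : Bool) : Bool := s && t && p && q && !b

theorem cornerGift_le (b s t p s' q t' : Bool) :
    cornerGift b s t p s' q t' ≤ 10 * ind s + 10 * ind t := by
  revert b s t p s' q t'; decide

theorem cornerGift_small (s t p s' q t' : Bool) : cornerGift false s t p s' q t' = 0 := rfl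

theorem cornerGift_false (b p s' q t' : Bool) : cornerGift b false false p s' q t' = 0 := by
  cases b <;> rfl

/-- At most two of the five faces are triangles. The corner between two triangles takes 20. A corner
with one triangular edge is served along its other edge, and each edge serves its two corners with
at most 10 together: 5 each if its far end is big, otherwise 10 to only one of them, by the
hypotheses `k₀` to `k₄`. -/
theorem degree_five_count (t₀ t₁ t₂ t₃ t₄ g₀ g₁ g₂ g₃ g₄ l₀ l₁ l₂ l₃ l₄ m₀ m₁ m₂ m₃ m₄ : Bool)
    (h₀ : t₀ → ¬ t₁) (h₁ : t₁ → ¬ t₂) (h₂ : t₂ → ¬ t₃) (h₃ : t₃ → ¬ t₄) (h₄ : t₄ → ¬ t₀)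
    (k₀ : ¬ g₀ → l₀ → ¬ m₀) (k₁ : ¬ g₁ → l₁ → ¬ m₁) (k₂ : ¬ g₂ → l₂ → ¬ m₂)
    (k₃ : ¬ g₃ → l₃ → ¬ m₃) (k₄ : ¬ g₄ → l₄ → ¬ m₄) :
    cornerGift true t₄ t₁ g₄ l₄ g₀ m₀ + cornerGift true t₀ t₂ g₀ l₀ g₁ m₁ +
    cornerGift true t₁ t₃ g₁ l₁ g₂ m₂ + cornerGift true t₂ t₄ g₂ l₂ g₃ m₃ +
    cornerGift true t₃ t₀ g₃ l₃ g₄ m₄ ≤ 30 := by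
  cases t₀ <;> cases t₁ <;> cases t₂ <;> cases t₃ <;> cases t₄ <;>
    first
    | (exfalso; simp at h₀ h₁ h₂ h₃ h₄; done)
    | (clear h₀ h₁ h₂ h₃ h₄
       simp only [cornerGift, if_true, if_false, Bool.false_eq_true]
       (try split_ifs) <;> simp_all)

/-- The extreme case fixes the constant 4: five triangular edges and no big vertex give 30 - 50 + 5
· 4 = 0. -/
theorem pentagon_count (u₀ u₁ u₂ u₃ u₄ b₀ b₁ b₂ b₃ b₄ : Bool) :
    0 ≤ 30 - 10 * (ind u₀ + ind u₁ + ind u₂ + ind u₃ + ind u₄) +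
      (cornerGift b₀ u₄ u₀ b₄ u₃ b₁ u₁ + cornerGift b₁ u₀ u₁ b₀ u₄ b₂ u₂ +
        cornerGift b₂ u₁ u₂ b₁ u₀ b₃ u₃ + cornerGift b₃ u₂ u₃ b₂ u₁ b₄ u₄ +
        cornerGift b₄ u₃ u₄ b₃ u₂ b₀ u₀) +
      4 * (ind (u₄ && u₀ && !(b₀ || b₁ || b₂ || b₃ || b₄)) +
        ind (u₀ && u₁ && !(b₀ || b₁ || b₂ || b₃ || b₄)) +
        ind (u₁ && u₂ && !(b₀ || b₁ || b₂ || b₃ || b₄)) +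
        ind (u₂ && u₃ && !(b₀ || b₁ || b₂ || b₃ || b₄)) +
        ind (u₃ && u₄ && !(b₀ || b₁ || b₂ || b₃ || b₄))) -
      4 * (ind (alternating u₄ u₀ b₄ b₀ b₁) + ind (alternating u₀ u₁ b₀ b₁ b₂) +
        ind (alternating u₁ u₂ b₁ b₂ b₃) + ind (alternating u₂ u₃ b₂ b₃ b₄) +
        ind (alternating u₃ u₄ b₃ b₄ b₀)) := by
  revert u₀ u₁ u₂ u₃ u₄ b₀ b₁ b₂ b₃ b₄
  decide

/-- One corner's share of a face of length at least six. It owns at least 10 and pays half of the 10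
due across each of its two edges. The 4 due at an alternating corner is paid half by each
neighbouring corner; those are at big vertices. -/
theorem large_face_count (u₀ u₁ u₂ u₃ b₀ b₁ b₂ b₃ b₄ : Bool) :
    0 ≤ 5 * (1 - ind u₁) + 5 * (1 - ind u₂) + cornerGift b₂ u₁ u₂ b₁ u₀ b₃ u₃ -
      2 * ind (alternating u₀ u₁ b₀ b₁ b₂) - 2 * ind (alternating u₂ u₃ b₂ b₃ b₄) := by
  revert u₀ u₁ u₂ u₃ b₀ b₁ b₂ b₃ b₄
  decide


/-! ### Discharging on a map -/

/-- A map in which no face of length three has a neighbour of length at most four, all degrees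
are at least four, and no pentagon together with an adjacent triangle has all degrees four.
Here `σ` rotates around vertices, `α` reverses darts and `φ` traces faces. -/
structure SparseMap {D : Type*} (σ α φ : Perm D) : Prop where
  face : ∀ d, φ d = σ (α d)
  alpha_alpha : ∀ d, α (α d) = d
  degree : ∀ d, 4 ≤ minimalPeriod σ d
  length : ∀ d, 3 ≤ minimalPeriod φ d
  triangle : ∀ d, minimalPeriod φ d = 3 → 5 ≤ minimalPeriod φ (α d)
  pentagon : ∀ d, minimalPeriod φ d = 5 → minimalPeriod φ (α d) = 3 →
    minimalPeriod σ d = 4 → minimalPeriod σ (φ d) = 4 → minimalPeriod σ (φ (φ d)) = 4 →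
    minimalPeriod σ (φ (φ (φ d))) = 4 → minimalPeriod σ (φ (φ (φ (φ d)))) = 4 →
    5 ≤ minimalPeriod σ (φ (φ (α d)))

section Discharging

variable {D : Type*}

/-- The face of the dart is a triangle. -/
noncomputable def isTriangle (φ : Perm D) (d : D) : Bool := decide (minimalPeriod φ d = 3)

/-- The tail of the dart has degree at least five. -/
noncomputable def isBig (σ : Perm D) (d : D) : Bool := decide (5 ≤ minimalPeriod σ d)

/-- The edge of the dart is on a triangle on the other side. -/
noncomputable def isTriangular (α φ : Perm D) (d : D) : Bool := isTriangle φ (α d)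

/-- What the tail of `d` gives to the face of `d`. -/
noncomputable def gift (σ α φ : Perm D) (d : D) : ℤ :=
  cornerGift (isBig σ d) (isTriangular α φ (φ⁻¹ d)) (isTriangular α φ d)
    (isBig σ (φ⁻¹ d)) (isTriangular α φ (φ⁻¹ (φ⁻¹ d))) (isBig σ (φ d)) (isTriangular α φ (φ d))

/-- The corner at the tail of `d` in the face of `d` is alternating. -/
noncomputable def isAlternating (σ α φ : Perm D) (d : D) : Bool :=
  alternating (isTriangular α φ (φ⁻¹ d)) (isTriangular α φ d) (isBig σ (φ⁻¹ d)) (isBig σ d)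
    (isBig σ (φ d))

/-- The face of `d` is a pentagon without big vertices, and both edges at the tail of `d` are
triangular. -/
noncomputable def isPoor (σ α φ : Perm D) (d : D) : Bool :=
  decide (minimalPeriod φ d = 5) && (isTriangular α φ (φ⁻¹ d) && isTriangular α φ d &&
    !(isBig σ d || isBig σ (φ d) || isBig σ (φ (φ d)) || isBig σ (φ (φ (φ d))) ||
      isBig σ (φ (φ (φ (φ d))))))

theorem iterate_eq_of_minimalPeriod {π : Perm D} {d : D} {n : ℕ} (h : minimalPeriod π d = n) :
    π^[n] d = d := by
  rw [← h]; exact iterate_minimalPeriod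

theorem SparseMap.face_alpha {σ α φ : Perm D} (M : SparseMap σ α φ) (d : D) :
    φ (α d) = σ d := by rw [M.face, M.alpha_alpha]

theorem SparseMap.alpha_face_inv {σ α φ : Perm D} (M : SparseMap σ α φ) (d : D) :
    α (φ⁻¹ d) = σ⁻¹ d := by
  rw [Perm.eq_inv_iff_eq, ← M.face]; simp

theorem SparseMap.face_inv {σ α φ : Perm D} (M : SparseMap σ α φ) (d : D) :
    φ⁻¹ d = α (σ⁻¹ d) := by
  rw [← M.alpha_face_inv, M.alpha_alpha]

variable [Finite D]

theorem minimalPeriod_perm_apply (π : Perm D) (d : D) :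
    minimalPeriod π (π d) = minimalPeriod π d :=
  (minimalPeriod_congr (apply_rel π d)).symm

theorem minimalPeriod_perm_inv_apply (π : Perm D) (d : D) :
    minimalPeriod π (π⁻¹ d) = minimalPeriod π d :=
  (minimalPeriod_congr (sameCycle_inv_apply_self π d)).symm

end Discharging

section Discharging

variable {D : Type*} {σ α φ : Perm D}

theorem perm_inv_apply_self (π : Perm D) (d : D) : π⁻¹ (π d) = d := by simp

theorem SparseMap.isTriangular_face_inv (M : SparseMap σ α φ) (d : D) :
    isTriangular α φ (φ⁻¹ d) = isTriangle φ (σ⁻¹ d) := by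
  rw [isTriangular, M.alpha_face_inv]

theorem SparseMap.length_of_isTriangular (M : SparseMap σ α φ) {d : D}
    (h : isTriangular α φ d = true) : 5 ≤ minimalPeriod φ d := by
  simp only [isTriangular, isTriangle, decide_eq_true_eq] at h
  have := M.triangle _ h
  rwa [M.alpha_alpha] at this

theorem degree_eq_four_of_isBig (M : SparseMap σ α φ) {d : D} (h : isBig σ d = false) :
    minimalPeriod σ d = 4 := by
  simp only [isBig, decide_eq_false_iff_not] at h
  have := M.degree d
  omega

theorem SparseMap.isTriangular_of_short (M : SparseMap σ α φ) {d : D}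
    (h : minimalPeriod φ d < 5) : isTriangular α φ d = false := by
  by_contra hc
  have := M.length_of_isTriangular (Bool.eq_true_of_not_eq_false hc)
  omega

theorem isPoor_degree (M : SparseMap σ α φ) {d : D} (h : isPoor σ α φ d = true) :
    minimalPeriod φ d = 5 ∧ isTriangular α φ (φ⁻¹ d) = true ∧ isTriangular α φ d = true ∧
      minimalPeriod σ d = 4 ∧ minimalPeriod σ (φ d) = 4 ∧ minimalPeriod σ (φ (φ d)) = 4 ∧
      minimalPeriod σ (φ (φ (φ d))) = 4 ∧ minimalPeriod σ (φ (φ (φ (φ d)))) = 4 := by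
  simp only [isPoor, Bool.and_eq_true, decide_eq_true_eq, Bool.not_eq_true',
    Bool.or_eq_false_iff] at h
  obtain ⟨h5, ⟨hu', hu⟩, ⟨⟨⟨b0, b1⟩, b2⟩, b3⟩, b4⟩ := h
  exact ⟨h5, hu', hu, degree_eq_four_of_isBig M b0, degree_eq_four_of_isBig M b1,
    degree_eq_four_of_isBig M b2, degree_eq_four_of_isBig M b3, degree_eq_four_of_isBig M b4⟩

theorem SparseMap.isPoor_eq_false (M : SparseMap σ α φ) {d : D} (h : minimalPeriod φ d ≠ 5) :
    isPoor σ α φ d = false := by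
  by_contra hc
  exact h (isPoor_degree M (Bool.eq_true_of_not_eq_false hc)).1

variable [Finite D]

theorem isBig_rot (σ : Perm D) (d : D) : isBig σ (σ d) = isBig σ d := by
  simp only [isBig, minimalPeriod_perm_apply]

theorem isTriangle_face (φ : Perm D) (d : D) : isTriangle φ (φ d) = isTriangle φ d := by
  simp only [isTriangle, minimalPeriod_perm_apply]

theorem SparseMap.isTriangular_eq (M : SparseMap σ α φ) (d : D) :
    isTriangular α φ d = isTriangle φ (σ d) := by
  rw [isTriangular, ← isTriangle_face, M.face_alpha]

theorem SparseMap.isBig_face (M : SparseMap σ α φ) (d : D) : isBig σ (φ d) = isBig σ (α d) := by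
  rw [M.face, isBig_rot]

theorem SparseMap.not_isTriangle_rot (M : SparseMap σ α φ) {d : D} (h : isTriangle φ d = true) :
    isTriangle φ (σ d) = false := by
  simp only [isTriangle, decide_eq_true_eq, decide_eq_false_iff_not] at *
  have := M.triangle d h
  rw [← minimalPeriod_perm_apply, M.face_alpha] at this
  omega

theorem SparseMap.not_isTriangle_rot_inv (M : SparseMap σ α φ) {d : D}
    (h : isTriangle φ d = true) : isTriangle φ (σ⁻¹ d) = false := by
  by_contra hc
  have := M.not_isTriangle_rot (Bool.eq_true_of_not_eq_false hc)
  simp [h] at this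

/-- The gifts at a vertex of degree five. -/
theorem SparseMap.gift_window (M : SparseMap σ α φ) {d : D} (h : minimalPeriod σ d = 5) :
    gift σ α φ d + gift σ α φ (σ d) + gift σ α φ (σ (σ d)) + gift σ α φ (σ (σ (σ d))) +
      gift σ α φ (σ (σ (σ (σ d)))) ≤ 30 := by
  have h5 : σ (σ (σ (σ (σ d)))) = d := iterate_eq_of_minimalPeriod h
  have hinv : σ⁻¹ d = σ (σ (σ (σ d))) := by rw [Perm.inv_eq_iff_eq, h5]
  have hb : isBig σ d = true := by simp [isBig, h]
  have key : ∀ e : D, isBig σ e = true → gift σ α φ (σ e) = cornerGift true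
      (isTriangle φ e) (isTriangle φ (σ (σ e))) (isBig σ (α e)) (isTriangle φ (σ⁻¹ (α e)))
      (isBig σ (α (σ e))) (isTriangle φ (σ (σ (α (σ e))))) := by
    intro e he
    have e1 : φ⁻¹ (σ e) = α e := by rw [M.face_inv]; simp
    rw [gift, isBig_rot, he, M.isTriangular_face_inv, M.isTriangular_face_inv, e1,
      M.isTriangular_eq, M.isBig_face, M.isTriangular_eq, M.face]
    simp
  -- At a far end of degree four, `σ⁻¹` is the third power of `σ`, so the two faces in question are
  -- consecutive and cannot both be triangles.
  have hl : ∀ e : D, ¬ isBig σ (α e) = true → isTriangle φ (σ⁻¹ (α e)) = true →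
      ¬ isTriangle φ (σ (σ (α e))) = true := by
    intro e h1 h2 h3
    have h4 : σ (σ (σ (σ (α e)))) = α e :=
      iterate_eq_of_minimalPeriod (degree_eq_four_of_isBig M (Bool.eq_false_of_not_eq_true h1))
    have h6 : σ⁻¹ (α e) = σ (σ (σ (α e))) := by rw [Perm.inv_eq_iff_eq, h4]
    rw [h6, M.not_isTriangle_rot h3] at h2
    exact absurd h2 (by simp)
  have hn : ∀ e : D, isTriangle φ e = true → ¬ isTriangle φ (σ e) = true := fun e he => by
    rw [M.not_isTriangle_rot he]; simp
  have hb1 := (isBig_rot σ d).trans hb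
  have hb2 := (isBig_rot σ _).trans hb1
  have hb3 := (isBig_rot σ _).trans hb2
  have hb4 := (isBig_rot σ _).trans hb3
  have k0 := key d hb
  have k1 := key _ hb1
  have k2 := key _ hb2
  have k3 := key _ hb3
  have k4 := key _ hb4
  have n3 := hn (σ (σ (σ (σ d))))
  rw [h5] at k3 k4 n3
  rw [k0, k1, k2, k3, k4]
  have := degree_five_count (isTriangle φ d) (isTriangle φ (σ d)) (isTriangle φ (σ (σ d)))
    (isTriangle φ (σ (σ (σ d)))) (isTriangle φ (σ (σ (σ (σ d))))) _ _ _ _ _ _ _ _ _ _ _ _ _ _ _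
    (hn _) (hn _) (hn _) (hn _) n3 (hl d) (hl (σ d)) (hl (σ (σ d)))
    (hl (σ (σ (σ d)))) (hl (σ (σ (σ (σ d)))))
  linarith

/-- The total of the gifts is at most what the vertices can give. -/
theorem SparseMap.sum_vertex_nonneg [Fintype D] (M : SparseMap σ α φ) :
    0 ≤ ∑ d, (30 * (1 - 4 / (minimalPeriod σ d : ℚ)) - gift σ α φ d) := by
  classical
  rw [← Finset.sum_filter_add_sum_filter_not Finset.univ fun d => minimalPeriod σ d = 5]
  refine add_nonneg ?_ ?_
  · refine sum_filter_nonneg_of_window (π := σ) (fun d => by rw [minimalPeriod_perm_apply]) _ ?_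
    intro d hd
    have := M.gift_window hd
    simp only [minimalPeriod_perm_apply, hd]
    have h2 : (gift σ α φ d + gift σ α φ (σ d) + gift σ α φ (σ (σ d)) +
      gift σ α φ (σ (σ (σ d))) + gift σ α φ (σ (σ (σ (σ d)))) : ℚ) ≤ 30 := by exact_mod_cast this
    push_cast
    linarith
  · refine sum_filter_nonneg_of_telescope (π := σ) (fun d => by rw [minimalPeriod_perm_apply]) _
      -- At degree six or more each corner owns at least 10. A corner in a triangle gives nothing
      -- away and hands 5 to each of its two neighbours.
      (fun d => if isBig σ d then
        5 * (ind (isTriangle φ d) : ℚ) - 5 * ind (isTriangle φ (σ⁻¹ d)) else 0) ?_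
    intro d hd
    simp only [isBig_rot, perm_inv_apply_self]
    cases hb : isBig σ d
    · have h4 := degree_eq_four_of_isBig M hb
      simp [gift, hb, cornerGift_small, h4]
    · have h5 : 5 ≤ minimalPeriod σ d := by simpa [isBig] using hb
      have h6 : (6 : ℚ) ≤ minimalPeriod σ d := by exact_mod_cast (by omega : 6 ≤ _)
      have h7 : 10 ≤ 30 * (1 - 4 / (minimalPeriod σ d : ℚ)) := by
        have : 4 / (minimalPeriod σ d : ℚ) ≤ 4 / 6 := by gcongr
        linarith
      have h8 : gift σ α φ d ≤ 10 * ind (isTriangle φ (σ⁻¹ d)) + 10 * ind (isTriangle φ (σ d)) := by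
        rw [gift, M.isTriangular_face_inv d, M.isTriangular_eq d]
        exact cornerGift_le _ _ _ _ _ _ _
      have h9 : 10 * ind (isTriangle φ (σ⁻¹ d)) + 10 * ind (isTriangle φ (σ d)) ≤
          10 + 5 * ind (isTriangle φ (σ d)) - 5 * ind (isTriangle φ d) -
            (5 * ind (isTriangle φ d) - 5 * ind (isTriangle φ (σ⁻¹ d))) ∨
          gift σ α φ d ≤ 10 + 5 * ind (isTriangle φ (σ d)) - 5 * ind (isTriangle φ d) -
            (5 * ind (isTriangle φ d) - 5 * ind (isTriangle φ (σ⁻¹ d))) := by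
        cases ht : isTriangle φ d
        · left
          cases isTriangle φ (σ⁻¹ d) <;> cases isTriangle φ (σ d) <;> decide
        · right
          rw [M.not_isTriangle_rot ht, M.not_isTriangle_rot_inv ht] at *
          simpa [ind] using h8
      have h10 : gift σ α φ d ≤ 10 + 5 * ind (isTriangle φ (σ d)) - 5 * ind (isTriangle φ d) -
            (5 * ind (isTriangle φ d) - 5 * ind (isTriangle φ (σ⁻¹ d))) := by
        rcases h9 with h9 | h9
        · exact h8.trans h9
        · exact h9
      have h11 : (gift σ α φ d : ℚ) ≤ 10 + 5 * ind (isTriangle φ (σ d)) - 5 * ind (isTriangle φ d) -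
            (5 * ind (isTriangle φ d) - 5 * ind (isTriangle φ (σ⁻¹ d))) := by exact_mod_cast h10
      simp only [if_true]
      linarith

/-- The corner opposite to a poor corner is alternating. -/
theorem SparseMap.isAlternating_of_isPoor (M : SparseMap σ α φ) {d : D}
    (h : isPoor σ α φ (σ (σ d)) = true) : isAlternating σ α φ d = true := by
  obtain ⟨h5, hu', hu, d0, d1, d2, d3, d4⟩ := isPoor_degree M h
  set y := σ (σ d) with hy
  have hd : minimalPeriod σ d = 4 := by
    rw [← d0, hy, minimalPeriod_perm_apply, minimalPeriod_perm_apply]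
  have hrot : σ (σ (σ (σ d))) = d := iterate_eq_of_minimalPeriod hd
  have hyd : σ (σ y) = d := hrot
  have hy1 : σ⁻¹ d = σ y := by rw [Perm.inv_eq_iff_eq, hyd]
  have hy2 : σ⁻¹ y = σ d := by rw [Perm.inv_eq_iff_eq, hy]
  have hlast : φ (φ (φ (φ (φ y)))) = y := iterate_eq_of_minimalPeriod h5
  have hprev : φ (φ (φ (φ y))) = φ⁻¹ y := by rw [Perm.eq_inv_iff_eq, hlast]
  have t1 : isTriangular α φ (φ⁻¹ d) = true := by
    rw [M.isTriangular_face_inv, hy1, ← M.isTriangular_eq]; exact hu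
  have t2 : isTriangular α φ d = true := by
    rw [M.isTriangular_eq, ← hy2, ← M.isTriangular_face_inv]; exact hu'
  have hb : isBig σ d = false := by simp [isBig, hd]
  -- The apexes of the triangles across the two edges at the poor corner are big by `M.pentagon`;
  -- they are the two neighbours of the tail of `d` in the opposite face. The second one needs the
  -- condition for the preceding dart of the pentagon.
  have b1 : isBig σ (φ⁻¹ d) = true := by
    have hu2 : minimalPeriod φ (α y) = 3 := by simpa [isTriangular, isTriangle] using hu
    have := M.pentagon y h5 hu2 d0 d1 d2 d3 d4
    rw [M.face_alpha, M.face, minimalPeriod_perm_apply, ← hy1, ← M.face_inv] at this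
    simpa [isBig] using this
  have b2 : isBig σ (φ d) = true := by
    have hu2 : minimalPeriod φ (α (φ⁻¹ y)) = 3 := by simpa [isTriangular, isTriangle] using hu'
    have h5' : minimalPeriod φ (φ⁻¹ y) = 5 := by rw [minimalPeriod_perm_inv_apply, h5]
    have := M.pentagon (φ⁻¹ y) h5' hu2 (by rw [← hprev]; exact d4) (by simpa using d0)
      (by simpa using d1) (by simpa using d2) (by simpa using d3)
    have h3 : φ (φ (φ (α (φ⁻¹ y)))) = α (φ⁻¹ y) := iterate_eq_of_minimalPeriod hu2
    have h4 : φ (φ (α (φ⁻¹ y))) = α d := by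
      have : φ (φ (α (φ⁻¹ y))) = φ⁻¹ (α (φ⁻¹ y)) := by rw [Perm.eq_inv_iff_eq, h3]
      rw [this, M.alpha_face_inv, hy2, M.face_inv]
      simp
    rw [h4] at this
    rw [M.isBig_face]
    simpa [isBig] using this
  rw [isAlternating, t1, t2, hb, b1, b2]
  rfl

theorem SparseMap.ind_isPoor_le (M : SparseMap σ α φ) (d : D) :
    ind (isPoor σ α φ (σ (σ d))) ≤ ind (isAlternating σ α φ d) := by
  cases h : isPoor σ α φ (σ (σ d))
  · cases isAlternating σ α φ d <;> decide
  · rw [M.isAlternating_of_isPoor h]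

/-- Each dart of a pentagon carries 30 (1 - 4/5) = 6, and the five corners must be balanced
together. -/
theorem pentagon_window (σ α : Perm D) {φ : Perm D} {d : D} (h : minimalPeriod φ d = 5) :
    let f : D → ℤ := fun d => 6 - 10 * ind (isTriangular α φ d) + gift σ α φ d +
      4 * ind (isPoor σ α φ d) - 4 * ind (isAlternating σ α φ d)
    0 ≤ f d + f (φ d) + f (φ (φ d)) + f (φ (φ (φ d))) + f (φ (φ (φ (φ d)))) := by
  intro f
  have h5 : φ (φ (φ (φ (φ d)))) = d := iterate_eq_of_minimalPeriod h
  have hinv : φ⁻¹ d = φ (φ (φ (φ d))) := by rw [Perm.inv_eq_iff_eq, h5]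
  have key := pentagon_count (isTriangular α φ d) (isTriangular α φ (φ d))
    (isTriangular α φ (φ (φ d))) (isTriangular α φ (φ (φ (φ d))))
    (isTriangular α φ (φ (φ (φ (φ d))))) (isBig σ d) (isBig σ (φ d))
    (isBig σ (φ (φ d))) (isBig σ (φ (φ (φ d)))) (isBig σ (φ (φ (φ (φ d)))))
  have hp : ∀ e b₀ b₁ b₂ b₃ b₄, minimalPeriod φ e = 5 → isBig σ e = b₀ → isBig σ (φ e) = b₁ →
      isBig σ (φ (φ e)) = b₂ → isBig σ (φ (φ (φ e))) = b₃ → isBig σ (φ (φ (φ (φ e)))) = b₄ →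
      isPoor σ α φ e = (isTriangular α φ (φ⁻¹ e) && isTriangular α φ e &&
        !(b₀ || b₁ || b₂ || b₃ || b₄)) := by
    rintro e _ _ _ _ _ he rfl rfl rfl rfl rfl
    simp [isPoor, he]
  have g1 : minimalPeriod φ (φ d) = 5 := by rw [minimalPeriod_perm_apply, h]
  have g2 : minimalPeriod φ (φ (φ d)) = 5 := by rw [minimalPeriod_perm_apply, g1]
  have g3 : minimalPeriod φ (φ (φ (φ d))) = 5 := by rw [minimalPeriod_perm_apply, g2]
  have g4 : minimalPeriod φ (φ (φ (φ (φ d)))) = 5 := by rw [minimalPeriod_perm_apply, g3]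
  have p0 := hp d _ _ _ _ _ h rfl rfl rfl rfl rfl
  have p1 := hp (φ d) _ _ _ _ _ g1 rfl rfl rfl rfl rfl
  have p2 := hp (φ (φ d)) _ _ _ _ _ g2 rfl rfl rfl rfl rfl
  have p3 := hp (φ (φ (φ d))) _ _ _ _ _ g3 rfl rfl rfl rfl rfl
  have p4 := hp (φ (φ (φ (φ d)))) _ _ _ _ _ g4 rfl rfl rfl rfl rfl
  simp only [f, p0, p1, p2, p3, p4]
  simp only [gift, isAlternating, perm_inv_apply_self, h5, hinv]
  generalize isTriangular α φ d = u₀ at *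
  generalize isTriangular α φ (φ d) = u₁ at *
  generalize isTriangular α φ (φ (φ d)) = u₂ at *
  generalize isTriangular α φ (φ (φ (φ d))) = u₃ at *
  generalize isTriangular α φ (φ (φ (φ (φ d)))) = u₄ at *
  generalize isBig σ d = b₀ at *
  generalize isBig σ (φ d) = b₁ at *
  generalize isBig σ (φ (φ d)) = b₂ at *
  generalize isBig σ (φ (φ (φ d))) = b₃ at *
  generalize isBig σ (φ (φ (φ (φ d)))) = b₄ at *
  have c1 : (b₁ || b₂ || b₃ || b₄ || b₀) = (b₀ || b₁ || b₂ || b₃ || b₄) := by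
    cases b₀ <;> cases b₁ <;> cases b₂ <;> cases b₃ <;> cases b₄ <;> rfl
  have c2 : (b₂ || b₃ || b₄ || b₀ || b₁) = (b₀ || b₁ || b₂ || b₃ || b₄) := by
    cases b₀ <;> cases b₁ <;> cases b₂ <;> cases b₃ <;> cases b₄ <;> rfl
  have c3 : (b₃ || b₄ || b₀ || b₁ || b₂) = (b₀ || b₁ || b₂ || b₃ || b₄) := by
    cases b₀ <;> cases b₁ <;> cases b₂ <;> cases b₃ <;> cases b₄ <;> rfl
  have c4 : (b₄ || b₀ || b₁ || b₂ || b₃) = (b₀ || b₁ || b₂ || b₃ || b₄) := by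
    cases b₀ <;> cases b₁ <;> cases b₂ <;> cases b₃ <;> cases b₄ <;> rfl
  rw [c1, c2, c3, c4]
  linarith

/-- What the faces have received covers what they lack. -/
theorem SparseMap.sum_face_nonneg [Fintype D] (M : SparseMap σ α φ) :
    0 ≤ ∑ d, (30 * (1 - 4 / (minimalPeriod φ d : ℚ)) + 10 * ind (isTriangle φ d) -
      10 * ind (isTriangular α φ d) + gift σ α φ d + 4 * ind (isPoor σ α φ d) -
      4 * ind (isAlternating σ α φ d)) := by
  classical
  rw [← Finset.sum_filter_add_sum_filter_not Finset.univ fun d => minimalPeriod φ d = 5]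
  refine add_nonneg ?_ ?_
  · refine sum_filter_nonneg_of_window (π := φ) (fun d => by rw [minimalPeriod_perm_apply]) _ ?_
    intro d hd
    have := pentagon_window σ α hd
    have h2 := (Int.cast_nonneg_iff (R := ℚ)).2 this
    have ht : isTriangle φ d = false := by simp [isTriangle, hd]
    simp only [minimalPeriod_perm_apply, hd, isTriangle_face, ht]
    push_cast at h2
    have h3 : ((ind false : ℤ) : ℚ) = 0 := by simp [ind]
    rw [h3]
    push_cast
    linarith
  · refine sum_filter_nonneg_of_telescope (π := φ) (fun d => by rw [minimalPeriod_perm_apply]) _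
      -- Half of what is paid across an edge is moved to the corner at its other end, and the debt
      -- of an alternating corner to its two neighbours, as in `large_face_count`.
      (fun d => 5 * (ind (isTriangular α φ (φ⁻¹ d)) : ℚ) - 2 * ind (isAlternating σ α φ d) +
        2 * ind (isAlternating σ α φ (φ⁻¹ d))) ?_
    intro d hd
    simp only [perm_inv_apply_self, M.isPoor_eq_false hd]
    have h0 : ((ind false : ℤ) : ℚ) = 0 := by simp [ind]
    rw [h0]
    rcases lt_or_ge (minimalPeriod φ d) 5 with hlt | hge
    · have u : ∀ e, minimalPeriod φ e = minimalPeriod φ d → isTriangular α φ e = false :=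
        fun e he => M.isTriangular_of_short (by omega)
      have p1 := minimalPeriod_perm_apply φ d
      have p2 := minimalPeriod_perm_inv_apply φ d
      have a : ∀ e, minimalPeriod φ e = minimalPeriod φ d → isAlternating σ α φ e = false :=
        fun e he => by
          rw [isAlternating, u e he, alternating, Bool.and_false]; rfl
      have g : gift σ α φ d = 0 := by
        rw [gift, u _ p2, u d rfl, cornerGift_false]
      rw [u _ p2, u d rfl, a _ p1, a _ p2, a d rfl, g, h0]
      have := M.length d
      obtain h | h : minimalPeriod φ d = 3 ∨ minimalPeriod φ d = 4 := by omega
      · simp [isTriangle, h, ind]; norm_num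
      · simp [isTriangle, h, ind]
    · have h6 : (6 : ℚ) ≤ minimalPeriod φ d := by exact_mod_cast (by omega : 6 ≤ _)
      have h7 : 10 ≤ 30 * (1 - 4 / (minimalPeriod φ d : ℚ)) := by
        have : 4 / (minimalPeriod φ d : ℚ) ≤ 4 / 6 := by gcongr
        linarith
      have ht : isTriangle φ d = false := by
        simp only [isTriangle, decide_eq_false_iff_not]; omega
      rw [ht, h0]
      have key := (Int.cast_nonneg_iff (R := ℚ)).2 (large_face_count
        (isTriangular α φ (φ⁻¹ (φ⁻¹ d))) (isTriangular α φ (φ⁻¹ d)) (isTriangular α φ d)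
        (isTriangular α φ (φ d)) (isBig σ (φ⁻¹ (φ⁻¹ d))) (isBig σ (φ⁻¹ d)) (isBig σ d)
        (isBig σ (φ d)) (isBig σ (φ (φ d))))
      have e1 : isAlternating σ α φ (φ⁻¹ d) = alternating (isTriangular α φ (φ⁻¹ (φ⁻¹ d)))
          (isTriangular α φ (φ⁻¹ d)) (isBig σ (φ⁻¹ (φ⁻¹ d))) (isBig σ (φ⁻¹ d)) (isBig σ d) := by
        rw [isAlternating, show φ (φ⁻¹ d) = d by simp]
      have e2 : isAlternating σ α φ (φ d) = alternating (isTriangular α φ d)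
          (isTriangular α φ (φ d)) (isBig σ d) (isBig σ (φ d)) (isBig σ (φ (φ d))) := by
        rw [isAlternating, perm_inv_apply_self]
      have e3 : gift σ α φ d = cornerGift (isBig σ d) (isTriangular α φ (φ⁻¹ d))
        (isTriangular α φ d) (isBig σ (φ⁻¹ d)) (isTriangular α φ (φ⁻¹ (φ⁻¹ d)))
        (isBig σ (φ d)) (isTriangular α φ (φ d)) := rfl
      rw [← e1, ← e2, ← e3] at key
      push_cast at key
      linarith

/-- A sparse map has nonpositive Euler characteristic. -/
theorem SparseMap.sum_nonpos [Fintype D] (M : SparseMap σ α φ) :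
    ∑ d, (1 / (minimalPeriod σ d : ℚ) + 1 / (minimalPeriod φ d : ℚ) - 1 / 2) ≤ 0 := by
  have h1 := M.sum_vertex_nonneg
  have h2 := M.sum_face_nonneg
  have h3 : ∑ d, (ind (isTriangular α φ d) : ℚ) = ∑ d, (ind (isTriangle φ d) : ℚ) := by
    have := Equiv.sum_comp σ fun d => (ind (isTriangle φ d) : ℚ)
    rw [← this]
    simp only [M.isTriangular_eq]
  -- At a vertex of degree four `σ * σ` passes to the opposite corner. Alternating corners pay even
  -- when the opposite corner is not poor, hence only an inequality.
  have h4 : ∑ d, (ind (isPoor σ α φ d) : ℚ) ≤ ∑ d, (ind (isAlternating σ α φ d) : ℚ) := by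
    have := Equiv.sum_comp (σ * σ) fun d => (ind (isPoor σ α φ d) : ℚ)
    rw [← this]
    exact Finset.sum_le_sum fun d _ => by exact_mod_cast M.ind_isPoor_le d
  have h5 : ∑ d, (1 / (minimalPeriod σ d : ℚ) + 1 / (minimalPeriod φ d : ℚ) - 1 / 2) =
      -(1 / 120) * (∑ d, 30 * (1 - 4 / (minimalPeriod σ d : ℚ)) +
        ∑ d, 30 * (1 - 4 / (minimalPeriod φ d : ℚ))) := by
    rw [← Finset.sum_add_distrib, Finset.mul_sum]
    exact Finset.sum_congr rfl fun d _ => by ring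
  simp only [Finset.sum_sub_distrib, Finset.sum_add_distrib, ← Finset.mul_sum] at h1 h2
  rw [h5]
  simp only [← Finset.mul_sum, Finset.sum_sub_distrib]
  linarith

end Discharging

/-! ### Forests built vertex by vertex -/

section Forests

variable {V : Type*}

/-- The set `T` can be built up by adding vertices one at a time, each of them
related to at most one of the earlier ones. -/
inductive Buildable [DecidableEq V] (r : V → V → Prop) : Finset V → Prop
  | empty : Buildable r ∅
  | insert {T : Finset V} {x : V} (hT : Buildable r T) (hx : x ∉ T)
      (h : ∀ y ∈ T, ∀ z ∈ T, r x y → r x z → y = z) : Buildable r (insert x T)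

theorem Buildable.congr [DecidableEq V] {r s : V → V → Prop} {T : Finset V} (h : Buildable r T)
    (hrs : ∀ x ∈ T, ∀ y ∈ T, s x y → r x y) : Buildable s T := by
  induction h with
  | empty => exact .empty
  | insert hT hx h ih =>
    refine .insert (ih fun x hx y hy => hrs x (Finset.mem_insert_of_mem hx) y
      (Finset.mem_insert_of_mem hy)) hx fun y hy z hz hxy hxz => h y hy z hz ?_ ?_
    · exact hrs _ (Finset.mem_insert_self _ _) _ (Finset.mem_insert_of_mem hy) hxy
    · exact hrs _ (Finset.mem_insert_self _ _) _ (Finset.mem_insert_of_mem hz) hxz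

/-- The part of a graph inside a set of vertices. -/
def restrictTo (Γ : SimpleGraph V) (T : Finset V) : SimpleGraph V where
  Adj x y := x ∈ T ∧ y ∈ T ∧ Γ.Adj x y
  symm := ⟨fun _ _ h => ⟨h.2.1, h.1, h.2.2.symm⟩⟩
  loopless := ⟨fun _ h => h.2.2.ne rfl⟩

/-- The new vertex is isolated in the old graph, so its at most one new edge joins two different
components. -/
theorem Buildable.isAcyclic [DecidableEq V] {Γ : SimpleGraph V} {T : Finset V}
    (h : Buildable Γ.Adj T) : (restrictTo Γ T).IsAcyclic := by
  induction h with
  | empty =>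
    have : restrictTo Γ ∅ = ⊥ := by ext x y; simp [restrictTo]
    rw [this]
    exact SimpleGraph.isAcyclic_bot
  | @insert T x hT hx h ih =>
    by_cases hy : ∃ y ∈ T, Γ.Adj x y
    · obtain ⟨y, hy, hxy⟩ := hy
      have hnr : ¬ (restrictTo Γ T).Reachable x y := by
        rintro ⟨p⟩
        cases p with
        | nil => exact hx hy
        | cons h' _ => exact hx h'.1
      refine (ih.sup_edge_of_not_reachable hnr).anti ?_
      intro a b hab
      obtain ⟨ha, hb, hΓ⟩ := hab
      rw [SimpleGraph.sup_adj, SimpleGraph.edge_adj]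
      rcases Finset.mem_insert.1 ha with rfl | ha'
      · rcases Finset.mem_insert.1 hb with rfl | hb'
        · exact absurd rfl hΓ.ne
        · have := h y hy b hb' hxy hΓ
          subst this
          exact .inr ⟨.inl ⟨rfl, rfl⟩, hΓ.ne⟩
      · rcases Finset.mem_insert.1 hb with rfl | hb'
        · have := h y hy a ha' hxy hΓ.symm
          subst this
          exact .inr ⟨.inr ⟨rfl, rfl⟩, hΓ.ne⟩
        · exact .inl ⟨ha', hb', hΓ⟩
    · refine ih.anti ?_
      intro a b hab
      obtain ⟨ha, hb, hΓ⟩ := hab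
      rcases Finset.mem_insert.1 ha with rfl | ha'
      · rcases Finset.mem_insert.1 hb with rfl | hb'
        · exact absurd rfl hΓ.ne
        · exact absurd ⟨b, hb', hΓ⟩ hy
      · rcases Finset.mem_insert.1 hb with rfl | hb'
        · exact absurd ⟨a, ha', hΓ.symm⟩ hy
        · exact ⟨ha', hb', hΓ⟩

end Forests

/-! ### The reducible configuration as a finite search -/

section ThetaSearch

/-- The graph formed by a triangle `0, 1, 2` and a path `0, 3, 4, 5, 1`, every edge being labelled
by a truth value. -/
def thetaLabel (s₀ s₁ s₂ s₃ s₄ s₅ s₆ : Bool) : Fin 6 → Fin 6 → Option Bool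
  | 0, 1 => some s₀
  | 1, 0 => some s₀
  | 0, 2 => some s₁
  | 2, 0 => some s₁
  | 1, 2 => some s₂
  | 2, 1 => some s₂
  | 0, 3 => some s₃
  | 3, 0 => some s₃
  | 3, 4 => some s₄
  | 4, 3 => some s₄
  | 4, 5 => some s₅
  | 5, 4 => some s₅
  | 5, 1 => some s₆
  | 1, 5 => some s₆
  | _, _ => none

/-- The adjacency of a triangle and a five-cycle with a common edge. -/
def thetaAdj (x y : Fin 6) : Bool :=
  (thetaLabel false false false false false false false x y).isSome

/-- The colours `b` of `x` and `b'` of `y` are matched. -/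
def thetaConflict (l : Fin 6 → Fin 6 → Option Bool) (x : Fin 6) (b : Bool) (y : Fin 6)
    (b' : Bool) : Bool :=
  match l x y with
  | some s => b' == xor b s
  | none => false

/-- The number of outer neighbours with which the colour `b` of `x` is matched. The truth value
belonging to `x` says that for both colours this number is one. -/
def thetaOuter (z₂ z₃ z₄ z₅ : Bool) (x : Fin 6) (b : Bool) : ℕ :=
  match x with
  | 0 => if b then 1 else 0
  | 1 => if b then 1 else 0
  | 2 => if z₂ then 1 else if b then 2 else 0
  | 3 => if z₃ then 1 else if b then 2 else 0
  | 4 => if z₄ then 1 else if b then 2 else 0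
  | 5 => if z₅ then 1 else if b then 2 else 0

/-- Depth-first search for a colouring of the listed vertices, each of which may conflict with at
most one earlier vertex. -/
def greedySearch (l : Fin 6 → Fin 6 → Option Bool) (out : Fin 6 → Bool → ℕ) :
    List (Fin 6) → List (Fin 6 × Bool) → Bool
  | [], _ => true
  | x :: o, e =>
    (Nat.ble (out x false + (e.filter fun y => thetaConflict l x false y.1 y.2).length) 1 &&
      greedySearch l out o ((x, false) :: e)) ||
    (Nat.ble (out x true + (e.filter fun y => thetaConflict l x true y.1 y.2).length) 1 &&
      greedySearch l out o ((x, true) :: e))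

/-- An exhaustive check of `2 ^ 11` cases: seven matchings, and four ways in which the outer
conflicts of `2, 3, 4, 5` are split between the colours. One of the two orders always succeeds. -/
theorem greedySearch_theta (s₀ s₁ s₂ s₃ s₄ s₅ s₆ z₂ z₃ z₄ z₅ : Bool) :
    (greedySearch (thetaLabel s₀ s₁ s₂ s₃ s₄ s₅ s₆) (thetaOuter z₂ z₃ z₄ z₅)
        [2, 0, 1, 5, 4, 3] [] ||
      greedySearch (thetaLabel s₀ s₁ s₂ s₃ s₄ s₅ s₆) (thetaOuter z₂ z₃ z₄ z₅)
        [3, 4, 0, 5, 2, 1] []) = true := by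
  revert s₀ s₁ s₂ s₃ s₄ s₅ s₆ z₂ z₃ z₄ z₅
  decide +kernel

end ThetaSearch

/-! ### Extending colourings of a cover -/

section Colouring

variable {V : Type u} {C : Type w} {G : SimpleGraph V} {L : V → Finset C}
  {H : SimpleGraph (CoverVertex L)}

/-- The representative graph of a choice of one colour for each vertex. -/
def conflictGraph (H : SimpleGraph (CoverVertex L)) (c : ∀ v, {a : C // a ∈ L v}) :
    SimpleGraph V where
  Adj x y := x ≠ y ∧ H.Adj ⟨x, c x⟩ ⟨y, c y⟩
  symm := ⟨fun _ _ h => ⟨h.1.symm, h.2.symm⟩⟩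
  loopless := ⟨fun _ h => h.1 rfl⟩

theorem IsCover.adj_of_ne (hH : IsCover G L H) {x y : V} (hne : x ≠ y) {i : {a : C // a ∈ L x}}
    {j : {a : C // a ∈ L y}} (h : H.Adj ⟨x, i⟩ ⟨y, j⟩) : G.Adj x y := by
  by_contra hc
  exact hH.not_adj x y hne hc i j h

/-- Calling the less conflicting colour `false` leaves only the distributions listed in
`thetaOuter`. -/
theorem exists_colour_pair (x : V) (hL : (L x).card = 2) (n : {a : C // a ∈ L x} → ℕ) :
    ∃ g : Bool → {a : C // a ∈ L x}, g false ≠ g true ∧ n (g false) ≤ n (g true) := by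
  classical
  obtain ⟨a, b, hab, hL⟩ := Finset.card_eq_two.1 hL
  have ha : a ∈ L x := by simp [hL]
  have hb : b ∈ L x := by simp [hL]
  rcases le_total (n ⟨a, ha⟩) (n ⟨b, hb⟩) with h | h
  · exact ⟨fun t => if t then ⟨b, hb⟩ else ⟨a, ha⟩, by simpa using hab, by simpa using h⟩
  · exact ⟨fun t => if t then ⟨a, ha⟩ else ⟨b, hb⟩, by simpa using hab.symm, by simpa using h⟩

/-- A matching between two pairs of colours lies in one of the two perfect matchings. Treating the
latter as the conflicts only makes the search harder. -/
theorem exists_label (hH : IsCover G L H) {x y : V} (hne : x ≠ y) {g : Bool → {a : C // a ∈ L x}}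
    {g' : Bool → {a : C // a ∈ L y}} (hg : g false ≠ g true) (hg' : g' false ≠ g' true) :
    ∃ s : Bool, ∀ b b', H.Adj ⟨x, g b⟩ ⟨y, g' b'⟩ → b' = xor b s := by
  by_cases h00 : H.Adj ⟨x, g false⟩ ⟨y, g' false⟩
  · have ha := hH.adj_of_ne hne h00
    refine ⟨false, fun b b' h => ?_⟩
    cases b <;> cases b'
    · rfl
    · exact absurd (hH.matching x y ha _ _ _ h00 h) hg'
    · exact absurd (hH.matching y x ha.symm _ _ _ h00.symm h.symm) hg
    · rfl
  by_cases h11 : H.Adj ⟨x, g true⟩ ⟨y, g' true⟩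
  · have ha := hH.adj_of_ne hne h11
    refine ⟨false, fun b b' h => ?_⟩
    cases b <;> cases b'
    · rfl
    · exact absurd (hH.matching y x ha.symm _ _ _ h11.symm h.symm) hg.symm
    · exact absurd (hH.matching x y ha _ _ _ h11 h) hg'.symm
    · rfl
  · refine ⟨true, fun b b' h => ?_⟩
    cases b <;> cases b'
    · exact absurd h h00
    · rfl
    · rfl
    · exact absurd h h11

variable [DecidableEq V]

open Classical in
/-- The vertices of `T` whose colour is matched with the colour `i` of `x`. -/
noncomputable def opponents (H : SimpleGraph (CoverVertex L)) (c : ∀ v, {a : C // a ∈ L v})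
    (T : Finset V) (x : V) (i : {a : C // a ∈ L x}) : Finset V :=
  T.filter fun y => x ≠ y ∧ H.Adj ⟨x, i⟩ ⟨y, c y⟩

-- The colour of `y` is matched with at most one colour of `x`, so no neighbour is counted twice.
open Classical in
theorem card_opponents_add_le (hH : IsCover G L H) (c : ∀ v, {a : C // a ∈ L v})
    (T : Finset V) (x : V) {i j : {a : C // a ∈ L x}} (hij : i ≠ j) :
    (opponents H c T x i).card + (opponents H c T x j).card ≤ (T.filter (G.Adj x)).card := by
  rw [← Finset.card_union_of_disjoint]
  · refine Finset.card_le_card fun y hy => ?_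
    simp only [opponents, Finset.mem_union, Finset.mem_filter] at hy ⊢
    rcases hy with hy | hy <;> exact ⟨hy.1, hH.adj_of_ne hy.2.1 hy.2.2⟩
  · rw [Finset.disjoint_left]
    intro y hy hy'
    simp only [opponents, Finset.mem_filter] at hy hy'
    exact hij (hH.matching y x (hH.adj_of_ne hy.2.1 hy.2.2).symm _ _ _ hy.2.2.symm hy'.2.2.symm)

theorem buildable_update {c : ∀ v, {a : C // a ∈ L v}} {T : Finset V}
    (hT : Buildable (conflictGraph H c).Adj T) {x : V} (hx : x ∉ T) (i : {a : C // a ∈ L x})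
    (h : (opponents H c T x i).card ≤ 1) :
    Buildable (conflictGraph H (Function.update c x i)).Adj (insert x T) := by
  have hne : ∀ y ∈ T, y ≠ x := fun y hy h => hx (h ▸ hy)
  refine .insert (hT.congr fun y hy z hz hyz => ?_) hx fun y hy z hz hxy hxz => ?_
  · simpa [conflictGraph, Function.update_of_ne (hne y hy), Function.update_of_ne (hne z hz)]
      using hyz
  · rw [Finset.card_le_one] at h
    refine h y ?_ z ?_
    · simp only [opponents, Finset.mem_filter]
      simpa [conflictGraph, Function.update_of_ne (hne y hy), hy] using hxy
    · simp only [opponents, Finset.mem_filter]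
      simpa [conflictGraph, Function.update_of_ne (hne z hz), hz] using hxz

open Classical in
theorem extend_of_degree_le_three (hH : IsCover G L H) (hL : ∀ v, (L v).card = 2)
    {c : ∀ v, {a : C // a ∈ L v}} {T : Finset V}
    (hT : Buildable (conflictGraph H c).Adj T) {x : V} (hx : x ∉ T)
    (hd : (T.filter (G.Adj x)).card ≤ 3) :
    ∃ c' : ∀ v, {a : C // a ∈ L v}, Buildable (conflictGraph H c').Adj (insert x T) := by
  obtain ⟨g, hne, hle⟩ := exists_colour_pair x (hL x) fun i => (opponents H c T x i).card
  have := card_opponents_add_le hH c T x hne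
  exact ⟨_, buildable_update hT hx (g false) (by omega)⟩

/-- The list `e` records the colours chosen so far. Since `c` agrees with `c₀` on `T`, the opponents
of the next vertex number at most its outer bound plus its conflicts with `e`, which is what the
search tests. -/
theorem greedySearch_sound {k : Fin 6 → V} (hk : Function.Injective k)
    {g : ∀ x, Bool → {a : C // a ∈ L (k x)}} {l : Fin 6 → Fin 6 → Option Bool}
    {out : Fin 6 → Bool → ℕ} {c₀ : ∀ v, {a : C // a ∈ L v}} {T : Finset V} (hkT : ∀ x, k x ∉ T)
    (hout : ∀ x b, (opponents H c₀ T (k x) (g x b)).card ≤ out x b)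
    (hl : ∀ x y, x ≠ y → ∀ b b', H.Adj ⟨k x, g x b⟩ ⟨k y, g y b'⟩ →
      thetaConflict l x b y b' = true) :
    ∀ (o : List (Fin 6)) (e : List (Fin 6 × Bool)) (c : ∀ v, {a : C // a ∈ L v}),
      greedySearch l out o e = true → (o ++ e.map Prod.fst).Nodup → (∀ v ∈ T, c v = c₀ v) →
      (∀ y ∈ e, c (k y.1) = g y.1 y.2) →
      Buildable (conflictGraph H c).Adj (T ∪ (e.map fun y => k y.1).toFinset) →
      ∃ c' : ∀ v, {a : C // a ∈ L v},
        Buildable (conflictGraph H c').Adj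
          (T ∪ ((e.map fun y => k y.1).toFinset ∪ (o.map k).toFinset)) := by
  classical
  intro o
  induction o with
  | nil => intro e c _ _ _ _ h; exact ⟨c, by simpa using h⟩
  | cons x o ih =>
    intro e c hs hnd hc hce hb
    have hxe : ∀ y ∈ e, y.1 ≠ x := by
      intro y hy hyx
      rw [List.cons_append, List.nodup_cons] at hnd
      exact hnd.1 (List.mem_append_right _ (List.mem_map.2 ⟨y, hy, hyx⟩))
    have hxT : k x ∉ T ∪ (e.map fun y => k y.1).toFinset := by
      simp only [Finset.mem_union, List.mem_toFinset, List.mem_map, not_or, not_exists, not_and]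
      exact ⟨hkT x, fun y hy h => hxe y hy (hk h)⟩
    obtain ⟨b, h1, h2⟩ : ∃ b, out x b +
        (e.filter fun y => thetaConflict l x b y.1 y.2).length ≤ 1 ∧
        greedySearch l out o ((x, b) :: e) = true := by
      simp only [greedySearch, Bool.or_eq_true, Bool.and_eq_true, Nat.ble_eq] at hs
      rcases hs with hs | hs
      · exact ⟨false, hs⟩
      · exact ⟨true, hs⟩
    have hcard : (opponents H c (T ∪ (e.map fun y => k y.1).toFinset) (k x) (g x b)).card ≤ 1 := by
      refine le_trans (le_trans (Finset.card_le_card (t := opponents H c₀ T (k x) (g x b) ∪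
        ((e.filter fun y => thetaConflict l x b y.1 y.2).map fun y => k y.1).toFinset) ?_)
        (Finset.card_union_le _ _)) (le_trans (add_le_add (hout x b)
          (List.toFinset_card_le _)) (by simpa using h1))
      intro v hv
      simp only [opponents, Finset.mem_filter, Finset.mem_union, List.mem_toFinset, List.mem_map,
        List.mem_filter] at hv ⊢
      obtain ⟨hv, hne, hadj⟩ := hv
      rcases hv with hv | ⟨y, hy, rfl⟩
      · rw [hc v hv] at hadj
        exact .inl ⟨hv, hne, hadj⟩
      · rw [hce y hy] at hadj
        exact .inr ⟨y, ⟨hy, hl x y.1 (hxe y hy).symm b y.2 hadj⟩, rfl⟩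
    have hb' := buildable_update hb hxT (g x b) hcard
    have := ih ((x, b) :: e) _ h2 ?_ ?_ ?_ (by
      rw [List.map_cons, List.toFinset_cons, Finset.union_insert]; exact hb')
    · obtain ⟨c', hc'⟩ := this
      refine ⟨c', ?_⟩
      have heq : (((x, b) :: e).map fun y => k y.1).toFinset ∪ (o.map k).toFinset =
          (e.map fun y => k y.1).toFinset ∪ ((x :: o).map k).toFinset := by
        simp [Finset.union_insert, Finset.insert_union]
      rwa [heq] at hc'
    · rw [List.map_cons]
      exact (List.perm_middle).nodup_iff.2 hnd
    · intro v hv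
      rw [Function.update_of_ne (by rintro rfl; exact hkT x hv), hc v hv]
    · intro y hy
      rcases List.mem_cons.1 hy with rfl | hy
      · simp
      · rw [Function.update_of_ne (fun h => hxe y hy (hk h)), hce y hy]

open Classical in
/-- A colouring extends to a triangle and a five-cycle with a common edge, if all their vertices
have degree at most four. -/
theorem extend_theta (hH : IsCover G L H) (hL : ∀ v, (L v).card = 2)
    {c : ∀ v, {a : C // a ∈ L v}} {T : Finset V} (hT : Buildable (conflictGraph H c).Adj T)
    {k : Fin 6 → V} (hk : Function.Injective k) (hkT : ∀ x, k x ∉ T)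
    (hadj : ∀ x y, G.Adj (k x) (k y) → thetaAdj x y = true)
    (hdeg : ∀ x, (T.filter (G.Adj (k x))).card ≤ if x = 0 ∨ x = 1 then 1 else 2) :
    ∃ c' : ∀ v, {a : C // a ∈ L v},
      Buildable (conflictGraph H c').Adj (T ∪ Finset.univ.image k) := by
  choose g hg hle using fun x =>
    exists_colour_pair (k x) (hL (k x)) fun i => (opponents H c T (k x) i).card
  have hsum : ∀ x, (opponents H c T (k x) (g x false)).card +
      (opponents H c T (k x) (g x true)).card ≤ if x = 0 ∨ x = 1 then 1 else 2 := fun x =>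
    (card_opponents_add_le hH c T (k x) (hg x)).trans (hdeg x)
  choose s hs using fun (x y : Fin 6) (h : x ≠ y) =>
    exists_label hH (fun he => h (hk he)) (hg x) (hg y)
  let z : Fin 6 → Bool := fun x => decide ((opponents H c T (k x) (g x false)).card = 1)
  let l := thetaLabel (s 0 1 (by decide)) (s 0 2 (by decide)) (s 1 2 (by decide))
    (s 0 3 (by decide)) (s 3 4 (by decide)) (s 4 5 (by decide)) (s 5 1 (by decide))
  let out := thetaOuter (z 2) (z 3) (z 4) (z 5)
  have hout : ∀ x b, (opponents H c T (k x) (g x b)).card ≤ out x b := by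
    -- The two counts add up to at most two, the one for `false` being no larger: either it is 1 and
    -- the other is 1, or it is 0 and the other at most 2.
    have h2 : ∀ x : Fin 6, ¬ (x = 0 ∨ x = 1) → ∀ b, (opponents H c T (k x) (g x b)).card ≤
        if z x then 1 else if b then 2 else 0 := by
      intro x hx b
      have h1 := hsum x
      have h2 := hle x
      rw [if_neg hx] at h1
      simp only [z, decide_eq_true_eq]
      by_cases hz : (opponents H c T (k x) (g x false)).card = 1
      · rw [if_pos hz]
        cases b <;> omega
      · rw [if_neg hz]
        cases b
        · rw [if_neg Bool.false_ne_true]; omega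
        · rw [if_pos rfl]; omega
    have h1 : ∀ x : Fin 6, (x = 0 ∨ x = 1) → ∀ b, (opponents H c T (k x) (g x b)).card ≤
        if b then 1 else 0 := by
      intro x hx b
      have h1 := hsum x
      have h2 := hle x
      rw [if_pos hx] at h1
      cases b
      · rw [if_neg Bool.false_ne_true]; omega
      · rw [if_pos rfl]; omega
    intro x b
    fin_cases x
    · exact h1 0 (by decide) b
    · exact h1 1 (by decide) b
    · exact h2 2 (by decide) b
    · exact h2 3 (by decide) b
    · exact h2 4 (by decide) b
    · exact h2 5 (by decide) b
  have hflip : ∀ {b b' t : Bool}, b' = xor b t → b = xor b' t := by decide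
  have hl : ∀ x y, x ≠ y → ∀ b b', H.Adj ⟨k x, g x b⟩ ⟨k y, g y b'⟩ →
      thetaConflict l x b y b' = true := by
    intro x y hxy b b' h
    have ha := hadj x y (hH.adj_of_ne (fun he => hxy (hk he)) h)
    have h1 := fun hn => hs x y hn b b' h
    have h2 := fun hn => hflip (hs y x hn b' b h.symm)
    clear h hsum hle hout hadj hdeg
    fin_cases x <;> fin_cases y <;> first
      | exact absurd ha (by decide)
      | exact decide_eq_true (h1 (by decide))
      | exact decide_eq_true (h2 (by decide))
  have search := greedySearch_theta (s 0 1 (by decide)) (s 0 2 (by decide)) (s 1 2 (by decide))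
    (s 0 3 (by decide)) (s 3 4 (by decide)) (s 4 5 (by decide)) (s 5 1 (by decide))
    (z 2) (z 3) (z 4) (z 5)
  have fin : ∀ o : List (Fin 6), o.Nodup → (∀ x, x ∈ o) → greedySearch l out o [] = true →
      ∃ c' : ∀ v, {a : C // a ∈ L v},
        Buildable (conflictGraph H c').Adj (T ∪ Finset.univ.image k) := by
    intro o ho hmem hso
    obtain ⟨c', hc'⟩ := greedySearch_sound hk hkT hout hl o [] c hso (by simpa using ho)
      (fun _ _ => rfl) (by simp) (by simpa using hT)
    refine ⟨c', ?_⟩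
    have heq : (([] : List (Fin 6 × Bool)).map fun y => k y.1).toFinset ∪ (o.map k).toFinset =
        Finset.univ.image k := by
      ext v; simp [hmem]
    rwa [heq] at hc'
  rcases Bool.or_eq_true _ _ ▸ search with h | h
  · exact fin _ (by decide) (by decide) h
  · exact fin _ (by decide) (by decide) h

end Colouring

/-! ### Five-cycles and triangles have no extra adjacencies -/

section ShortCycles

variable {V : Type*} {G : SimpleGraph V}

/-- No triangle `a b c` shares its edge `a b` with a four-cycle `a b e g`. -/
theorem not_triangle_fourCycle (hG : ¬ HasFourCycleAdjThreeCycle G) {a b c e g : V}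
    (hab : G.Adj a b) (hbc : G.Adj b c) (hca : G.Adj c a) (hbe : G.Adj b e) (heg : G.Adj e g)
    (hga : G.Adj g a) (hae : a ≠ e) (hbg : b ≠ g) : False := by
  refine hG ⟨a, a, .cons hab (.cons hbe (.cons heg (.cons hga .nil))),
    .cons hab (.cons hbc (.cons hca .nil)), ?_, rfl, ?_, rfl, s(a, b), by simp, by simp⟩
  · have := hab.ne; have := hbe.ne; have := heg.ne; have := hga.ne
    simp only [SimpleGraph.Walk.isCycle_def, SimpleGraph.Walk.isTrail_def]
    simp
    aesop
  · have := hab.ne; have := hbc.ne; have := hca.ne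
    simp only [SimpleGraph.Walk.isCycle_def, SimpleGraph.Walk.isTrail_def]
    simp
    aesop

/-- The chord would cut the five-cycle into the triangle `a b c` and the four-cycle `a c d e`. -/
theorem not_chord (hG : ¬ HasFourCycleAdjThreeCycle G) {a b c d e : V} (hab : G.Adj a b)
    (hbc : G.Adj b c) (hcd : G.Adj c d) (hde : G.Adj d e) (hea : G.Adj e a) (had : a ≠ d)
    (hce : c ≠ e) : ¬ G.Adj a c := fun h =>
  not_triangle_fourCycle hG h hbc.symm hab.symm hcd hde hea had hce

/-- A five-cycle and a triangle with a common edge have no further adjacencies. -/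
theorem exists_theta (hG : ¬ HasFourCycleAdjThreeCycle G) {w₀ w₁ w₂ w₃ w₄ t : V}
    (h₀ : G.Adj w₀ w₁) (h₁ : G.Adj w₁ w₂) (h₂ : G.Adj w₂ w₃) (h₃ : G.Adj w₃ w₄)
    (h₄ : G.Adj w₄ w₀) (d₀ : w₂ ≠ w₀) (d₁ : w₃ ≠ w₁) (d₂ : w₄ ≠ w₂) (d₃ : w₀ ≠ w₃)
    (d₄ : w₁ ≠ w₄) (ht₀ : G.Adj w₀ t) (ht₁ : G.Adj t w₁) :
    Function.Injective ![w₀, w₁, t, w₄, w₃, w₂] ∧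
      ∀ x y, G.Adj (![w₀, w₁, t, w₄, w₃, w₂] x) (![w₀, w₁, t, w₄, w₃, w₂] y) ↔
        thetaAdj x y = true := by
  have n02 : ¬ G.Adj w₀ w₂ := not_chord hG h₀ h₁ h₂ h₃ h₄ d₃ d₂.symm
  have n13 : ¬ G.Adj w₁ w₃ := not_chord hG h₁ h₂ h₃ h₄ h₀ d₄ d₃.symm
  have n24 : ¬ G.Adj w₂ w₄ := not_chord hG h₂ h₃ h₄ h₀ h₁ d₀ d₄.symm
  have n30 : ¬ G.Adj w₃ w₀ := not_chord hG h₃ h₄ h₀ h₁ h₂ d₁ d₀.symm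
  have n41 : ¬ G.Adj w₄ w₁ := not_chord hG h₄ h₀ h₁ h₂ h₃ d₂ d₁.symm
  have t2 : t ≠ w₂ := by rintro rfl; exact n02 ht₀
  have t3 : t ≠ w₃ := by rintro rfl; exact n30 ht₀.symm
  have t4 : t ≠ w₄ := by rintro rfl; exact n41 ht₁
  -- An edge from `t` to `w₂`, `w₄` or `w₃` closes a four-cycle through an edge of the triangle `w₀
  -- w₁ t`.
  have nt2 : ¬ G.Adj t w₂ := fun h =>
    not_triangle_fourCycle hG h₀ ht₁.symm ht₀.symm h₁ h.symm ht₀.symm d₀.symm ht₁.ne'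
  have nt4 : ¬ G.Adj t w₄ := fun h =>
    not_triangle_fourCycle hG h₀.symm ht₀ ht₁ h₄.symm h.symm ht₁ d₄ ht₀.ne
  have nt3 : ¬ G.Adj t w₃ := fun h =>
    not_triangle_fourCycle hG ht₁ h₀.symm ht₀ h₁ h₂ h.symm t2 d₁.symm
  constructor
  · intro x y hxy
    have e0 := h₀.ne; have e1 := h₁.ne; have e2 := h₂.ne; have e3 := h₃.ne; have e4 := h₄.ne
    have e5 := ht₀.ne; have e6 := ht₁.ne
    fin_cases x <;> fin_cases y <;> first
      | rfl
      | (exfalso; simp at hxy; simp_all)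
  · have n20 := fun h : G.Adj w₂ w₀ => n02 h.symm
    have n31 := fun h : G.Adj w₃ w₁ => n13 h.symm
    have n42 := fun h : G.Adj w₄ w₂ => n24 h.symm
    have n03 := fun h : G.Adj w₀ w₃ => n30 h.symm
    have n14 := fun h : G.Adj w₁ w₄ => n41 h.symm
    have n2t := fun h : G.Adj w₂ t => nt2 h.symm
    have n3t := fun h : G.Adj w₃ t => nt3 h.symm
    have n4t := fun h : G.Adj w₄ t => nt4 h.symm
    have l := fun v : V => G.irrefl (v := v)
    intro x y
    fin_cases x <;> fin_cases y <;> first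
      | exact iff_of_true (by assumption) (by decide)
      | exact iff_of_true (SimpleGraph.Adj.symm (by assumption)) (by decide)
      | exact iff_of_false (by assumption) (by decide)
      | exact iff_of_false (l _) (by decide)

end ShortCycles

/-! ### From maps drawn in a graph to sparse maps -/

section DrawnMaps

variable {V : Type*} {G : SimpleGraph V} {D : Type*} {σ α φ : Perm D}

/-- A map drawn with the vertices and edges of a graph, in which all degrees are at least
four. -/
structure DrawnMap (G : SimpleGraph V) (tail : D → V) (σ α φ : Perm D) : Prop where
  face : ∀ d, φ d = σ (α d)
  alpha_alpha : ∀ d, α (α d) = d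
  adj : ∀ d, G.Adj (tail d) (tail (α d))
  rot : ∀ d, tail (σ d) = tail d
  ext : ∀ d e, tail d = tail e → tail (α d) = tail (α e) → d = e
  degree : ∀ d, 4 ≤ minimalPeriod σ d

variable {tail : D → V}

theorem DrawnMap.tail_face (M : DrawnMap G tail σ α φ) (d : D) : tail (φ d) = tail (α d) := by
  rw [M.face, M.rot]

theorem DrawnMap.adj_face (M : DrawnMap G tail σ α φ) (d : D) : G.Adj (tail d) (tail (φ d)) := by
  rw [M.tail_face]; exact M.adj d

theorem DrawnMap.face_alpha (M : DrawnMap G tail σ α φ) (d : D) : φ (α d) = σ d := by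
  rw [M.face, M.alpha_alpha]

/-- A face walk that turns back makes `α d` a fixed point of `σ`, a vertex of degree one. Hence
short face walks are genuine cycles. -/
theorem DrawnMap.tail_face_face_ne (M : DrawnMap G tail σ α φ) (d : D) :
    tail (φ (φ d)) ≠ tail d := by
  intro h
  have h1 : φ d = α d := M.ext _ _ (M.tail_face d) (by rw [← M.tail_face, h, M.alpha_alpha])
  rw [M.face] at h1
  have h2 := M.degree (α d)
  have h3 : minimalPeriod σ (α d) = 1 := minimalPeriod_eq_one_iff_isFixedPt.2 h1
  omega

theorem DrawnMap.length [Finite D] (M : DrawnMap G tail σ α φ) (d : D) :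
    3 ≤ minimalPeriod φ d := by
  have h0 := minimalPeriod_pos φ d
  have h1 : minimalPeriod φ d ≠ 1 := fun h => by
    have h1 : φ d = d := iterate_eq_of_minimalPeriod h
    have := M.adj_face d
    rw [h1] at this
    exact G.irrefl this
  have h2 : minimalPeriod φ d ≠ 2 := fun h => by
    have h1 : φ (φ d) = d := iterate_eq_of_minimalPeriod h
    exact M.tail_face_face_ne d (by rw [h1])
  omega

/-- A face of length four across the edge is a four-cycle. Two triangles on an edge form a
four-cycle with their other edges, unless their apexes coincide; then `σ (σ d) = d`, against the
degree condition. -/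
theorem DrawnMap.triangle [Finite D] (M : DrawnMap G tail σ α φ)
    (hG : ¬ HasFourCycleAdjThreeCycle G) {d : D} (h : minimalPeriod φ d = 3) :
    5 ≤ minimalPeriod φ (α d) := by
  have hd : φ (φ (φ d)) = d := iterate_eq_of_minimalPeriod h
  have ab := M.adj_face d
  have bc := M.adj_face (φ d)
  have ca := M.adj_face (φ (φ d))
  rw [hd] at ca
  have hb : tail (α d) = tail (φ d) := (M.tail_face d).symm
  have ha : tail (φ (α d)) = tail d := by rw [M.face_alpha, M.rot]
  have ag := M.adj_face (φ (α d))
  rw [ha] at ag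
  have h0 := M.length (α d)
  have h3 : minimalPeriod φ (α d) ≠ 3 := fun h => by
    have he : φ (φ (φ (α d))) = α d := iterate_eq_of_minimalPeriod h
    have gb := M.adj_face (φ (φ (α d)))
    rw [he, hb] at gb
    refine not_triangle_fourCycle hG bc ca ab ca ag gb ab.ne' fun hcg => ?_
    have h1 : φ (φ d) = α (σ d) := by
      rw [← M.face_alpha]
      refine M.ext _ _ ?_ ?_
      · rw [hcg, M.tail_face]
      · rw [← M.tail_face, hd, M.alpha_alpha, ha]
    have h2 : σ (σ d) = d := by
      rw [← M.face_alpha (σ d), ← h1, hd]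
    have h4 : minimalPeriod σ d ≤ 2 := IsPeriodicPt.minimalPeriod_le (by norm_num) h2
    have := M.degree d
    omega
  have h4 : minimalPeriod φ (α d) ≠ 4 := fun h => by
    have he : φ (φ (φ (φ (α d)))) = α d := iterate_eq_of_minimalPeriod h
    have gh := M.adj_face (φ (φ (α d)))
    have hb' := M.adj_face (φ (φ (φ (α d))))
    rw [he, hb] at hb'
    refine not_triangle_fourCycle hG ab.symm ca.symm bc.symm ag gh hb' ?_ ?_
    · rw [← hb]; exact (M.tail_face_face_ne (α d)).symm
    · rw [← ha]; exact (M.tail_face_face_ne (φ (α d))).symm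
  omega

/-- A drawn map of positive Euler characteristic contains a five-cycle and a triangle with a
common edge, all vertices having degree four. -/
theorem DrawnMap.exists_theta [Fintype D] (M : DrawnMap G tail σ α φ)
    (hG : ¬ HasFourCycleAdjThreeCycle G)
    (hpos : 0 < ∑ d, (1 / (minimalPeriod σ d : ℚ) + 1 / (minimalPeriod φ d : ℚ) - 1 / 2)) :
    ∃ k : Fin 6 → V, Function.Injective k ∧ (∀ x y, G.Adj (k x) (k y) ↔ thetaAdj x y = true) ∧
      ∀ x, ∃ d, tail d = k x ∧ minimalPeriod σ d = 4 := by
  by_contra hc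
  refine absurd (SparseMap.sum_nonpos (σ := σ) (α := α) (φ := φ)
    ⟨M.face, M.alpha_alpha, M.degree, M.length, fun d => M.triangle hG, ?_⟩) (not_le.2 hpos)
  intro d h5 h3 d0 d1 d2 d3 d4
  by_contra htop
  refine hc ?_
  have hd : φ (φ (φ (φ (φ d)))) = d := iterate_eq_of_minimalPeriod h5
  have he : φ (φ (φ (α d))) = α d := iterate_eq_of_minimalPeriod h3
  have dt : minimalPeriod σ (φ (φ (α d))) = 4 := by
    have := M.degree (φ (φ (α d)))
    omega
  have hb : tail (α d) = tail (φ d) := (M.tail_face d).symm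
  have ha : tail (φ (α d)) = tail d := by rw [M.face_alpha, M.rot]
  have a4 := M.adj_face (φ (φ (φ (φ d))))
  have t0 := M.adj_face (φ (α d))
  have t1 := M.adj_face (φ (φ (α d)))
  have n3 := M.tail_face_face_ne (φ (φ (φ d)))
  have n4 := M.tail_face_face_ne (φ (φ (φ (φ d))))
  rw [hd] at a4 n3 n4
  rw [ha] at t0
  rw [he, hb] at t1
  obtain ⟨hinj, hadj⟩ := DPArboricity.exists_theta hG (M.adj_face d) (M.adj_face _)
    (M.adj_face _) (M.adj_face _) a4 (M.tail_face_face_ne d) (M.tail_face_face_ne _)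
    (M.tail_face_face_ne _) n3 n4 t0 t1
  refine ⟨_, hinj, hadj, fun x => ?_⟩
  fin_cases x
  · exact ⟨_, rfl, d0⟩
  · exact ⟨_, rfl, d1⟩
  · exact ⟨_, rfl, dt⟩
  · exact ⟨_, rfl, d4⟩
  · exact ⟨_, rfl, d3⟩
  · exact ⟨_, rfl, d2⟩

end DrawnMaps

/-! ### Euler's formula for the dart permutations and deletion of edges -/

section PlanarMaps

variable {V : Type*} {G : SimpleGraph V}

/-- The reversal of darts. -/
def reversal (G : SimpleGraph V) : Perm G.Dart :=
  Function.Involutive.toPerm SimpleGraph.Dart.symm SimpleGraph.Dart.symm_involutive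

theorem fst_skip [DecidableEq G.Dart] {σ : Perm G.Dart} (h : ∀ d, (σ d).fst = d.fst)
    (x d : G.Dart) : (skip σ x d).fst = d.fst := by
  by_cases h1 : d = x
  · rw [h1, skip_apply_self]
  by_cases h2 : σ d = x
  · rw [skip_apply_of_eq h2, h, ← h2, h]
  · rw [skip_apply_of_ne h1 h2, h]

theorem skip_fixed {D : Type*} [DecidableEq D] {σ : Perm D} {d : D} (h : σ d = d) (x : D) :
    skip σ x d = d := by
  by_cases h1 : d = x
  · rw [h1, skip_apply_self]
  · rw [skip_apply_of_ne h1 (by rwa [h]), h]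

instance [Finite V] : Finite G.Dart :=
  Finite.of_injective SimpleGraph.Dart.toProd SimpleGraph.Dart.toProd_injective

/-- Isolated vertices have no darts, but each accounts for one vertex, one face and one component,
so it cancels in Euler's formula. One-sided estimates of the other counts suffice. -/
theorem spherical_of_euler [Finite V] (R : RotationSystem G)
    (h : Nat.card V + R.numFaces = Nat.card G.edgeSet + 2 * Nat.card G.ConnectedComponent) :
    Spherical R.rot (reversal G) := by
  classical
  cases nonempty_fintype V
  have hD : Nat.card G.Dart = 2 * Nat.card G.edgeSet := by
    rw [Nat.card_eq_fintype_card, G.dart_card_eq_twice_card_edges, Nat.card_eq_fintype_card,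
      SimpleGraph.edgeFinset_card]
  have hE : Nat.card G.edgeSet ≤ numCycles (reversal G) := by
    have hle : SameCycle.setoid (reversal G) ≤
        Setoid.ker fun d : G.Dart => (⟨d.edge, d.edge_mem⟩ : G.edgeSet) :=
      setoid_le_of_apply fun a => Subtype.ext a.edge_symm.symm
    refine Nat.card_le_card_of_surjective (Quotient.lift _ fun a b hab => hle hab) ?_
    rintro ⟨e, he⟩
    induction e using Sym2.ind with
    | _ x y => exact ⟨Quotient.mk'' ⟨(x, y), he⟩, rfl⟩
  have hV : Nat.card V ≤ numCycles R.rot + Nat.card {v : V // ∀ w, ¬ G.Adj v w} := by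
    have hle : SameCycle.setoid R.rot ≤ Setoid.ker fun d : G.Dart => d.fst :=
      setoid_le_of_apply fun a => (R.fst_rot a).symm
    rw [numCycles, ← Nat.card_sum]
    refine Nat.card_le_card_of_surjective
      (Sum.elim (Quotient.lift _ fun a b hab => hle hab) Subtype.val) ?_
    intro v
    by_cases hv : ∀ w, ¬ G.Adj v w
    · exact ⟨.inr ⟨v, hv⟩, rfl⟩
    · push Not at hv
      obtain ⟨w, hw⟩ := hv
      exact ⟨.inl (Quotient.mk'' ⟨(v, w), hw⟩), rfl⟩
  have hC : Nat.card (Quotient (connSetoid R.rot (reversal G))) +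
      Nat.card {v : V // ∀ w, ¬ G.Adj v w} ≤ Nat.card G.ConnectedComponent := by
    have hle : connSetoid R.rot (reversal G) ≤
        Setoid.ker fun d : G.Dart => G.connectedComponentMk d.fst := by
      refine connSetoid_le (fun a => ?_) fun a => ?_
      · simp [Setoid.ker_def, R.fst_rot]
      · exact SimpleGraph.ConnectedComponent.sound a.adj.reachable
    have hreach : ∀ (u v : V) (p : G.Walk u v) (d e : G.Dart), d.fst = u → e.fst = v →
        connSetoid R.rot (reversal G) d e := by
      intro u v p
      have hrot : ∀ d e : G.Dart, d.fst = e.fst → connSetoid R.rot (reversal G) d e :=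
        fun d e hde => (le_sup_left : SameCycle.setoid R.rot ≤ connSetoid R.rot (reversal G))
          (R.sameCycle d e hde)
      induction p with
      | nil => intro d e hd he; exact hrot d e (hd.trans he.symm)
      | @cons u x v hux p ih =>
        intro d e hd he
        have h1 := hrot d ⟨(u, x), hux⟩ hd
        have h2 := connSetoid_right R.rot (reversal G) ⟨(u, x), hux⟩
        exact (connSetoid R.rot (reversal G)).trans h1
          ((connSetoid R.rot (reversal G)).trans h2 (ih _ e rfl he))
    rw [← Nat.card_sum]
    refine Nat.card_le_card_of_injective
      (Sum.elim (Quotient.lift _ fun a b hab => hle hab) fun v => G.connectedComponentMk v.1) ?_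
    have hiso : ∀ (v : {v : V // ∀ w, ¬ G.Adj v w}) (w : V), G.Reachable v.1 w → v.1 = w := by
      rintro v w ⟨p⟩
      cases p with
      | nil => rfl
      | cons h' _ => exact absurd h' (v.2 _)
    rintro (a | a) (b | b) hab
    · induction a using Quotient.inductionOn' with | _ a => ?_
      induction b using Quotient.inductionOn' with | _ b => ?_
      obtain ⟨p⟩ := SimpleGraph.ConnectedComponent.exact hab
      exact congrArg Sum.inl (Quotient.sound' (hreach _ _ p a b rfl rfl))
    · induction a using Quotient.inductionOn' with | _ a => ?_
      have h1 : G.Reachable a.fst b.1 := SimpleGraph.ConnectedComponent.exact hab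
      have h2 := hiso b _ h1.symm
      exact absurd (h2 ▸ a.adj) (b.2 _)
    · induction b using Quotient.inductionOn' with | _ b => ?_
      have h1 : G.Reachable a.1 b.fst := SimpleGraph.ConnectedComponent.exact hab
      have h2 := hiso a _ h1
      exact absurd (h2 ▸ b.adj) (a.2 _)
    · have h1 : G.Reachable a.1 b.1 := SimpleGraph.ConnectedComponent.exact hab
      exact congrArg Sum.inr (Subtype.ext (hiso a _ h1))
  have hF : R.numFaces = numCycles (R.rot * reversal G) +
      Nat.card {v : V // ∀ w, ¬ G.Adj v w} := rfl
  unfold Spherical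
  omega

/-- A map on the darts of a graph outside a set of deleted darts, which are fixed points of the
rotation and of the reversal. -/
structure DeletedMap (G : SimpleGraph V) [Finite V] (dead : Finset G.Dart)
    (σ α : Perm G.Dart) : Prop where
  alpha_live : ∀ d, d ∉ dead → α d = d.symm
  alpha_dead : ∀ d ∈ dead, α d = d
  rot_dead : ∀ d ∈ dead, σ d = d
  fst_rot : ∀ d, (σ d).fst = d.fst
  sameCycle : ∀ d d', d ∉ dead → d' ∉ dead → d.fst = d'.fst → σ.SameCycle d d'
  spherical : Spherical σ α

variable [Finite V]

theorem DeletedMap.delete [DecidableEq G.Dart] {dead : Finset G.Dart} {σ α : Perm G.Dart}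
    (M : DeletedMap G dead σ α) {d : G.Dart} (hd : d ∉ dead) (hd' : d.symm ∉ dead) :
    DeletedMap G (insert d (insert d.symm dead)) (skip (skip σ d) d.symm)
      (α * swap d d.symm) where
  alpha_live e he := by
    simp only [Finset.mem_insert, not_or] at he
    rw [Perm.mul_apply, swap_apply_of_ne_of_ne he.1 he.2.1, M.alpha_live e he.2.2]
  alpha_dead e he := by
    rw [Finset.mem_insert, Finset.mem_insert] at he
    rcases he with rfl | rfl | he
    · rw [Perm.mul_apply, swap_apply_left, M.alpha_live _ hd', SimpleGraph.Dart.symm_symm]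
    · rw [Perm.mul_apply, swap_apply_right, M.alpha_live _ hd]
    · rw [Perm.mul_apply, swap_apply_of_ne_of_ne, M.alpha_dead e he]
      · rintro rfl; exact hd he
      · rintro rfl; exact hd' he
  rot_dead e he := by
    rw [Finset.mem_insert, Finset.mem_insert] at he
    rcases he with rfl | rfl | he
    · exact skip_fixed (skip_apply_self _ _) _
    · exact skip_apply_self _ _
    · exact skip_fixed (skip_fixed (M.rot_dead e he) _) _
  fst_rot := fst_skip (fst_skip M.fst_rot d) d.symm
  sameCycle a b ha hb hab := by
    simp only [Finset.mem_insert, not_or] at ha hb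
    exact sameCycle_skip ha.2.1 hb.2.1 (sameCycle_skip ha.1 hb.1
      (M.sameCycle a b ha.2.2 hb.2.2 hab))
  spherical := by
    -- Cutting the edge makes both darts fixed points of the reversal, after which each can be
    -- skipped in the rotation.
    refine ((M.spherical.cut d.symm_ne.symm ?_).skip ?_).skip ?_
    · rw [← M.alpha_live d hd]; exact apply_rel α d
    · rw [Perm.mul_apply, swap_apply_left, M.alpha_live _ hd', SimpleGraph.Dart.symm_symm]
    · rw [Perm.mul_apply, swap_apply_right, M.alpha_live _ hd]

theorem exists_deletedMap (hG : IsPlanar G) (dead : Finset G.Dart)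
    (hdead : ∀ d ∈ dead, d.symm ∈ dead) : ∃ σ α, DeletedMap G dead σ α := by
  classical
  induction dead using Finset.strongInduction with
  | _ dead ih =>
    rcases dead.eq_empty_or_nonempty with rfl | ⟨d, hd⟩
    · obtain ⟨R, hR⟩ := hG
      exact ⟨R.rot, reversal G, fun _ _ => rfl, by simp, by simp, R.fst_rot,
        fun d d' _ _ h => R.sameCycle d d' h, spherical_of_euler R hR⟩
    · have hsub : (dead.erase d.symm).erase d ⊂ dead :=
        (Finset.erase_subset _ _).trans_ssubset (Finset.erase_ssubset (hdead d hd))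
      obtain ⟨σ, α, M⟩ := ih _ hsub (by
        intro e he
        simp only [Finset.mem_erase] at he ⊢
        refine ⟨?_, ?_, hdead e he.2.2⟩
        · rintro rfl; exact he.2.1 (SimpleGraph.Dart.symm_symm e).symm
        · intro h; exact he.1 (SimpleGraph.Dart.symm_involutive.injective h))
      have M' := M.delete (d := d) (by simp) (by simp)
      have heq : insert d (insert d.symm ((dead.erase d.symm).erase d)) = dead := by
        ext e
        simp only [Finset.mem_insert, Finset.mem_erase]
        by_cases h1 : e = d
        · simp [h1, hd]
        by_cases h2 : e = d.symm
        · simp [h2, hdead d hd]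
        · simp [h1, h2]
      exact ⟨_, _, heq ▸ M'⟩

end PlanarMaps

/-! ### Passing to an induced subgraph -/

section Restriction

theorem minimalPeriod_subtypePerm {D : Type*} {p : D → Prop} (π : Perm D)
    (h : ∀ d, p (π d) ↔ p d) (d : {d // p d}) :
    minimalPeriod (π.subtypePerm h) d = minimalPeriod π d.1 := by
  refine minimalPeriod_eq_minimalPeriod_iff.2 fun n => ?_
  have hs : Semiconj Subtype.val (π.subtypePerm h) π := fun _ => rfl
  have := (hs.iterate_right n) d
  rw [IsPeriodicPt, IsPeriodicPt, IsFixedPt, IsFixedPt, ← this, Subtype.ext_iff]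

theorem apply_notMem_iff {D : Type*} {π : Perm D} {s : Finset D} (h : ∀ d ∈ s, π d = d) (d : D) :
    π d ∉ s ↔ d ∉ s := by
  refine not_congr ⟨fun hd => ?_, fun hd => by rwa [h d hd]⟩
  have := π.injective (h _ hd)
  rwa [this] at hd

variable {V : Type*} {G : SimpleGraph V} [Finite V] {dead : Finset G.Dart} {σ α : Perm G.Dart}

/-- Deleted darts cancel in the Euler characteristic. -/
theorem DeletedMap.sum_pos (M : DeletedMap G dead σ α) [Fintype G.Dart]
    [Fintype {d // d ∉ dead}] (hne : ∃ d, d ∉ dead) :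
    0 < ∑ d : {d // d ∉ dead}, (1 / (minimalPeriod σ d.1 : ℚ) +
      1 / (minimalPeriod (σ * α) d.1 : ℚ) - 1 / 2) := by
  classical
  obtain ⟨d₀, hd₀⟩ := hne
  have hσ := apply_notMem_iff M.rot_dead
  have hα := apply_notMem_iff M.alpha_dead
  -- Every deleted dart is a component of its own, and the live darts give at least one more.
  have hC : dead.card + 1 ≤ Nat.card (Quotient (connSetoid σ α)) := by
    let f : G.Dart → Option {d // d ∈ dead} := fun d => if h : d ∈ dead then some ⟨d, h⟩ else none
    have hf : ∀ π : Perm G.Dart, (∀ d ∈ dead, π d = d) → ∀ a, Setoid.ker f a (π a) := by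
      intro π hπ a
      rw [Setoid.ker_def]
      by_cases ha : a ∈ dead
      · rw [hπ a ha]
      · have := (apply_notMem_iff hπ a).2 ha
        simp only [f, dif_neg ha, dif_neg this]
    have hle : connSetoid σ α ≤ Setoid.ker f :=
      connSetoid_le (hf σ M.rot_dead) (hf α M.alpha_dead)
    have hcard : Nat.card (Option {d // d ∈ dead}) = dead.card + 1 := by
      rw [Finite.card_option, Nat.card_eq_fintype_card, Fintype.card_coe]
    rw [← hcard]
    refine Nat.card_le_card_of_surjective (Quotient.lift f fun a b hab => hle hab) ?_
    rintro (_ | ⟨d, hd⟩)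
    · exact ⟨Quotient.mk'' d₀, by simp [Quotient.mk'', f, hd₀]⟩
    · exact ⟨Quotient.mk'' d, by simp [Quotient.mk'', f, hd]⟩
  let g : G.Dart → ℚ := fun d => 1 / (minimalPeriod σ d : ℚ) + 1 / (minimalPeriod α d : ℚ) +
    1 / (minimalPeriod (σ * α) d : ℚ) - 1
  have hsum : ∑ d, g d = (numCycles σ : ℚ) + numCycles α + numCycles (σ * α) -
      Nat.card G.Dart := by
    simp only [g, Finset.sum_sub_distrib, Finset.sum_add_distrib, sum_inv_minimalPeriod]
    simp [Nat.card_eq_fintype_card]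
  -- A deleted dart is a cycle of all three permutations: it adds 1 + 1 + 1 - 1 = 2, exactly what
  -- its own component demands in `Spherical`.
  have hdead : ∀ d : {d // ¬ d ∉ dead}, g d.1 = 2 := by
    rintro ⟨d, hd⟩
    rw [not_not] at hd
    have h1 : minimalPeriod σ d = 1 := minimalPeriod_eq_one_iff_isFixedPt.2 (M.rot_dead d hd)
    have h2 : minimalPeriod α d = 1 := minimalPeriod_eq_one_iff_isFixedPt.2 (M.alpha_dead d hd)
    have h3 : minimalPeriod (σ * α) d = 1 := minimalPeriod_eq_one_iff_isFixedPt.2 (by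
      rw [IsFixedPt, Perm.mul_apply, M.alpha_dead d hd, M.rot_dead d hd])
    simp only [g, h1, h2, h3]
    norm_num
  have hlive : ∀ d : {d // d ∉ dead}, g d.1 = 1 / (minimalPeriod σ d.1 : ℚ) +
      1 / (minimalPeriod (σ * α) d.1 : ℚ) - 1 / 2 := by
    rintro ⟨d, hd⟩
    have h2 : minimalPeriod α d = 2 := by
      have h1 : minimalPeriod α d ≤ 2 := IsPeriodicPt.minimalPeriod_le (by norm_num) (by
        change α (α d) = d
        rw [M.alpha_live _ ((hα d).2 hd), M.alpha_live d hd, SimpleGraph.Dart.symm_symm])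
      have h3 := minimalPeriod_pos α d
      have h4 : minimalPeriod α d ≠ 1 := fun h => by
        have : α d = d := minimalPeriod_eq_one_iff_isFixedPt.1 h
        rw [M.alpha_live d hd] at this
        exact d.symm_ne this
      omega
    simp only [g, h2]
    push_cast
    ring
  have hsplit := Fintype.sum_subtype_add_sum_subtype (fun d => d ∉ dead) g
  rw [Finset.sum_congr rfl fun d _ => hdead d, Finset.sum_congr rfl fun d _ => hlive d, hsum]
    at hsplit
  have hcard : (Finset.univ : Finset {d // ¬ d ∉ dead}).card = dead.card := by
    rw [Finset.card_univ, ← Fintype.card_coe dead]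
    exact Fintype.card_congr (Equiv.subtypeEquivRight fun d => not_not)
  rw [Finset.sum_const, hcard, nsmul_eq_mul] at hsplit
  have hS := M.spherical
  unfold Spherical at hS
  have hS' : (Nat.card G.Dart : ℚ) + 2 * (dead.card + 1) ≤
      numCycles σ + numCycles α + numCycles (σ * α) := by
    have : Nat.card G.Dart + 2 * (dead.card + 1) ≤
      numCycles σ + numCycles α + numCycles (σ * α) := by omega
    exact_mod_cast this
  have hpos : (0 : ℚ) < numCycles σ + numCycles α + numCycles (σ * α) - Nat.card G.Dart -
      dead.card * 2 := by linarith
  rw [← eq_sub_of_add_eq hsplit] at hpos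
  convert hpos

open Classical in
theorem exists_theta_of_planar (hG : IsPlanar G) (hG' : ¬ HasFourCycleAdjThreeCycle G)
    (S : Finset V) (hS : S.Nonempty) (hdeg : ∀ v ∈ S, 4 ≤ (S.filter (G.Adj v)).card) :
    ∃ k : Fin 6 → V, Function.Injective k ∧ (∀ x y, G.Adj (k x) (k y) ↔ thetaAdj x y = true) ∧
      ∀ x, k x ∈ S ∧ (S.filter (G.Adj (k x))).card = 4 := by
  have := Fintype.ofFinite G.Dart
  let dead : Finset G.Dart := Finset.univ.filter fun d => ¬ (d.fst ∈ S ∧ d.snd ∈ S)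
  have hmem : ∀ d, d ∉ dead ↔ d.fst ∈ S ∧ d.snd ∈ S := by simp [dead]
  have hsymm : ∀ d, d ∉ dead → d.symm ∉ dead := fun d hd => by
    rw [hmem] at hd ⊢; exact hd.symm
  obtain ⟨σ, α, M⟩ := exists_deletedMap hG dead fun d hd => by
    by_contra h; exact hsymm _ h (by rwa [SimpleGraph.Dart.symm_symm])
  have hσ := apply_notMem_iff M.rot_dead
  have hα := apply_notMem_iff M.alpha_dead
  have hφ : ∀ d, (σ * α) d ∉ dead ↔ d ∉ dead := fun d => by
    rw [Perm.mul_apply, hσ, hα]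
  -- The live darts at a vertex form a single cycle of `σ` and lead to its neighbours in `S`, so
  -- periods are degrees in the induced subgraph.
  have hcard : ∀ d, d ∉ dead → minimalPeriod σ d = (S.filter (G.Adj d.fst)).card := by
    intro d hd
    have hfst : SameCycle.setoid σ ≤ Setoid.ker fun e : G.Dart => e.fst :=
      setoid_le_of_apply fun a => (M.fst_rot a).symm
    have hliv : SameCycle.setoid σ ≤ Setoid.ker fun e : G.Dart => e ∉ dead :=
      setoid_le_of_apply fun a => propext (hσ a).symm
    rw [minimalPeriod_eq_card_sameCycle, ← Fintype.card_coe, ← Nat.card_eq_fintype_card]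
    have hy : ∀ y, σ.SameCycle d y → y.fst = d.fst ∧ y ∉ dead := fun y hy =>
      ⟨(hfst hy).symm, (iff_of_eq (hliv hy)).1 hd⟩
    refine Nat.card_eq_of_bijective (fun y : {y // σ.SameCycle d y} =>
      (⟨y.1.snd, ?_⟩ : {w // w ∈ S.filter (G.Adj d.fst)})) ⟨?_, ?_⟩
    · obtain ⟨h1, h2⟩ := hy y.1 y.2
      rw [Finset.mem_filter]
      exact ⟨((hmem _).1 h2).2, h1 ▸ y.1.adj⟩
    · rintro ⟨y, h1⟩ ⟨z, h2⟩ h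
      have h3 : y.snd = z.snd := congrArg Subtype.val h
      exact Subtype.ext (SimpleGraph.Dart.ext _ _
        (Prod.ext ((hy y h1).1.trans (hy z h2).1.symm) h3))
    · rintro ⟨w, hw⟩
      rw [Finset.mem_filter] at hw
      exact ⟨⟨⟨(d.fst, w), hw.2⟩, M.sameCycle _ _ hd
        ((hmem _).2 ⟨((hmem d).1 hd).1, hw.1⟩) rfl⟩, rfl⟩
  have hne : ∃ d, d ∉ dead := by
    obtain ⟨v, hv⟩ := hS
    obtain ⟨w, hw⟩ := Finset.card_pos.1 (lt_of_lt_of_le (by norm_num) (hdeg v hv))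
    rw [Finset.mem_filter] at hw
    exact ⟨⟨(v, w), hw.2⟩, (hmem _).2 ⟨hv, hw.1⟩⟩
  have D : DrawnMap G (fun d : {d // d ∉ dead} => d.1.fst) (σ.subtypePerm hσ)
      (α.subtypePerm hα) ((σ * α).subtypePerm hφ) := by
    have hαl : ∀ d : {d // d ∉ dead}, α d.1 = d.1.symm := fun d => M.alpha_live d.1 d.2
    refine ⟨fun d => rfl, fun d => Subtype.ext ?_, fun d => ?_, fun d => M.fst_rot d.1,
      fun d e h1 h2 => ?_, fun d => ?_⟩
    · change α (α d.1) = d.1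
      rw [M.alpha_live _ ((hα _).2 d.2), hαl, SimpleGraph.Dart.symm_symm]
    · change G.Adj d.1.fst (α d.1).fst
      rw [hαl]; exact d.1.adj
    · change (α d.1).fst = (α e.1).fst at h2
      rw [hαl, hαl] at h2
      exact Subtype.ext (SimpleGraph.Dart.ext _ _ (Prod.ext h1 h2))
    · rw [minimalPeriod_subtypePerm, hcard _ d.2]
      exact hdeg _ ((hmem _).1 d.2).1
  have hpos := M.sum_pos hne
  obtain ⟨k, hk, hadj, hk4⟩ := D.exists_theta hG' (by
    simpa only [minimalPeriod_subtypePerm] using hpos)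
  refine ⟨k, hk, hadj, fun x => ?_⟩
  obtain ⟨d, hd, h4⟩ := hk4 x
  rw [minimalPeriod_subtypePerm, hcard _ d.2] at h4
  rw [← hd]
  exact ⟨((hmem _).1 d.2).1, h4⟩

end Restriction

/-! ### Induction on vertex sets -/

section Main

variable {V : Type u} [Finite V] {C : Type w} {G : SimpleGraph V} {L : V → Finset C}
  {H : SimpleGraph (CoverVertex L)}

open Classical in
theorem exists_buildable (hG : IsPlanar G) (hG' : ¬ HasFourCycleAdjThreeCycle G)
    (hL : ∀ v, (L v).card = 2) (hH : IsCover G L H) (S : Finset V) :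
    ∃ c : ∀ v, {a : C // a ∈ L v}, Buildable (conflictGraph H c).Adj S := by
  induction S using Finset.strongInduction with
  | _ S ih =>
    rcases S.eq_empty_or_nonempty with rfl | hS
    · have hne : ∀ v, ∃ a, a ∈ L v := fun v =>
        Finset.card_pos.1 (by rw [hL v]; norm_num)
      choose c hc using hne
      exact ⟨fun v => ⟨c v, hc v⟩, .empty⟩
    by_cases hdeg : ∀ v ∈ S, 4 ≤ (S.filter (G.Adj v)).card
    · obtain ⟨k, hk, hadj, hk4⟩ := exists_theta_of_planar hG hG' S hS hdeg
      have hkS : Finset.univ.image k ⊆ S := fun v hv => by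
        obtain ⟨x, -, rfl⟩ := Finset.mem_image.1 hv
        exact (hk4 x).1
      obtain ⟨c, hc⟩ := ih (S \ Finset.univ.image k)
        (Finset.sdiff_ssubset hkS ⟨k 0, Finset.mem_image_of_mem k (Finset.mem_univ 0)⟩)
      -- The ends of the common edge have three neighbours in the configuration and the other
      -- vertices two. Of the four neighbours in `S` this leaves one or two outside, as
      -- `extend_theta` requires.
      have hcount : ∀ x : Fin 6, (Finset.univ.filter fun y => thetaAdj x y = true).card =
          if x = 0 ∨ x = 1 then 3 else 2 := by decide
      obtain ⟨c', hc'⟩ := extend_theta hH hL hc hk (by simp) (fun x y => (hadj x y).1) fun x => by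
        have h1 : ((S \ Finset.univ.image k).filter (G.Adj (k x))).card +
            ((Finset.univ.image k).filter (G.Adj (k x))).card = 4 := by
          rw [← (hk4 x).2, ← Finset.card_union_of_disjoint
            (Finset.disjoint_filter_filter Finset.sdiff_disjoint), ← Finset.filter_union,
            Finset.sdiff_union_of_subset hkS]
        have h2 : ((Finset.univ.image k).filter (G.Adj (k x))).card =
            (Finset.univ.filter fun y => thetaAdj x y = true).card := by
          rw [Finset.filter_image, Finset.card_image_of_injective _ hk]
          simp only [hadj]
        rw [hcount] at h2
        split_ifs at h2 ⊢ <;> omega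
      exact ⟨c', by rwa [Finset.sdiff_union_of_subset hkS] at hc'⟩
    · push Not at hdeg
      obtain ⟨v, hv, hlt⟩ := hdeg
      obtain ⟨c, hc⟩ := ih (S.erase v) (Finset.erase_ssubset hv)
      obtain ⟨c', hc'⟩ := extend_of_degree_le_three hH hL hc (Finset.notMem_erase v S)
        (le_trans (Finset.card_le_card (Finset.filter_subset_filter _ (Finset.erase_subset v S)))
          (Nat.le_of_lt_succ hlt))
      exact ⟨c', by rwa [Finset.insert_erase hv] at hc'⟩

end Main

end DPArboricity

theorem theorem1 {V : Type u} [Finite V] (G : SimpleGraph V)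
    (hplanar : DPArboricity.IsPlanar G)
    (hcycles : ¬ DPArboricity.HasFourCycleAdjThreeCycle G) :
    DPArboricity.IsDPVertexArborable.{u, w} G 2 := by
  classical
  intro C L hL H hH
  cases nonempty_fintype V
  obtain ⟨c, hc⟩ := DPArboricity.exists_buildable hplanar hcycles hL hH Finset.univ
  have hinj : Function.Injective fun v => (⟨v, c v⟩ : DPArboricity.CoverVertex L) :=
    fun v w h => congrArg Sigma.fst h
  have hmem : ∀ {v : V} {a : {a : C // a ∈ L v}},
      (⟨v, a⟩ : DPArboricity.CoverVertex L) ∈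
        Finset.univ.image (fun v => (⟨v, c v⟩ : DPArboricity.CoverVertex L)) → a = c v := by
    intro v a h
    obtain ⟨w, -, hw⟩ := Finset.mem_image.1 h
    cases hw
    rfl
  refine ⟨Finset.univ.image fun v => ⟨v, c v⟩, ⟨?_, ?_⟩, hc.isAcyclic.anti ?_⟩
  · rw [Finset.card_image_of_injective _ hinj, Finset.card_univ, Nat.card_eq_fintype_card]
  · intro x hx y hy hne h
    obtain ⟨v, -, rfl⟩ := Finset.mem_image.1 hx
    obtain ⟨w, -, rfl⟩ := Finset.mem_image.1 hy
    exact hne (by cases h; rfl)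
  · rintro x y ⟨hne, a, b, ha, hb, hab⟩
    rw [hmem ha, hmem hb] at hab
    exact ⟨Finset.mem_univ _, Finset.mem_univ _, hne, hab⟩
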